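/- **Setting.** For a nonzero vector $v\in\mathbb{R}^k$ and $p\ge 1$ let $\mathcal{D}^{(p)}_v$ be the distribution on $\{1,\dots,k\}$ with $\mathcal{D}^{(p)}_v(i)=|v_i|^p/\|v\|_p^p$. For $A\in\mathbb{R}^{m\times n}$ with columns $A^{(1)},\dots,A^{(n)}$, the data structure $\mathrm{SQ}_p(A)$ gives query access to the entries $A_{ij}$ and to the column norms $\|A^{(j)}\|_p^p$, and sample access to $\mathcal{D}^{(p)}_{A^{(j)}}$ for each $j$. Let $x\in\mathbb{R}^n$ be given by query access to its entries, with $Ax\neq 0$. A sample from $\mathcal{D}^{(p)}_{Ax}$ is drawn from $\mathrm{SQ}_p(A)$ by rejection sampling. The following iteration is repeated, independently, until a sample is output: 1. draw $j\in\{1,\dots,n\}$ with probability proportional to $\|x_jA^{(j)}\|_p^p$; 2. draw $i\sim\mathcal{D}^{(p)}_{A^{(j)}}$; 3. output $i$ with probability $r_i=\dfrac{|(Ax)_i|^p}{n^{p-1}\sum_{j'=1}^n|x_{j'}A_{ij'}|^p}\in[0,1]$, and otherwise reject. Let $M_p(A,x)$ be the expected number of iterations for one sample. One iteration makes $q_n=3n+1$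 accesses ($n$ entries of $x$, $n$ column norms, one sample from a column, $n$ entries of the row $A_i$), so the expected number of queries per sample is $Q_p(A,x)=q_n M_p(A,x)$. **Statement.** Let $\nu$ be a probability distribution on $\mathbb{R}$ with mean zero and finite variance, and let all the entries of the random matrix $A\in\mathbb{R}^{m\times n}$ and of the random vector $x\in\mathbb{R}^n$ be i.i.d. with distribution $\nu$. Averages are taken over $A$ and $x$, with values in $[0,\infty]$, conditionally on the event $Ax\ne 0$ that $\mathcal{D}^{(p)}_{Ax}$ exists (an event of probability one if $\nu$ has a density); if this event has probability zero, both sides of the inequalities below are read as $0$. (a) For every $p\ge 1$ with $\int|t|^p\,d\nu(t)<\infty$ there is $N=N(\nu,p)$ such that for all $m,n\ge N$ $$\mathbb{E}\bigl[Q_1(A,x)\,\big|\,Ax\neq0\bigr]\le\mathbb{E}\bigl[Q_p(A,x)\,\big|\,Ax\neq0\bigr],$$ that is, for $m,n\gg1$, $\mathrm{SQ}_1$ minimizes on average the expected number of queries per sample. (b) In particular there are $C=C(\nu)$ and $N=N(\nu)$ such that for all $m,n\ge N$ $$\mathbb{E}\bigl[M_1(A,x)\,\big|\,Ax\neq0\bigr]\le\frac{C}{\sqrt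 n}\;\mathbb{E}\bigl[M_2(A,x)\,\big|\,Ax\neq0\bigr],$$ that is, $\mathrm{SQ}_1$ needs on average $O(1/\sqrt n)$ times the number of iterations that $\mathrm{SQ}_2$ needs. -/

import Mathlib

open MeasureTheory ProbabilityTheory
open scoped ENNReal NNReal Matrix

namespace LpSampling

noncomputable section

/-- The `L^p` norm `‖v‖_p = (∑ i, |v i| ^ p) ^ (1 / p)` of a real vector. -/
def vecNorm {k : ℕ} (p : ℝ) (v : Fin k → ℝ) : ℝ :=
  (∑ i, |v i| ^ p) ^ (1 / p)

theorem tsum_weight_ne_zero {k : ℕ} (p : ℝ) (v : Fin k → ℝ) (hv : v ≠ 0) :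
    ∑' i, ENNReal.ofReal (|v i| ^ p) ≠ 0 := by
  obtain ⟨i, hi⟩ := Function.ne_iff.mp hv
  intro h
  have h0 := ENNReal.tsum_eq_zero.mp h i
  have hpos : 0 < |v i| ^ p := Real.rpow_pos_of_pos (abs_pos.mpr hi) p
  exact absurd (ENNReal.ofReal_eq_zero.mp h0) (not_le.mpr hpos)

theorem tsum_weight_ne_top {k : ℕ} (p : ℝ) (v : Fin k → ℝ) :
    ∑' i, ENNReal.ofReal (|v i| ^ p) ≠ ∞ := by
  rw [tsum_fintype]
  exact ENNReal.sum_ne_top.mpr fun i _ => ENNReal.ofReal_ne_top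

/-- The distribution `D_v^{(p)}` on the indices of a nonzero vector `v`:
`D_v^{(p)}(i) = |v i| ^ p / ∑ j, |v j| ^ p`. -/
def lpDist {k : ℕ} (p : ℝ) (v : Fin k → ℝ) (hv : v ≠ 0) : PMF (Fin k) :=
  PMF.normalize (fun i => ENNReal.ofReal (|v i| ^ p))
    (tsum_weight_ne_zero p v hv) (tsum_weight_ne_top p v)

open Classical in
/-- Draw an index from `D_v^{(p)}`; the draw fails (`none`) exactly when `v = 0`, in which case
`D_v^{(p)}` does not exist. -/
def drawIndex {k : ℕ} (p : ℝ) (v : Fin k → ℝ) : PMF (Option (Fin k)) :=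
  if hv : v ≠ 0 then (lpDist p v hv).map some else PMF.pure none

/-- The vector `(x_j ‖A^{(j)}‖_p)_j`, where `A^{(j)}` is the `j`-th column of `A`. -/
def weightedColumnNorms {m n : ℕ} (p : ℝ) (A : Matrix (Fin m) (Fin n) ℝ) (x : Fin n → ℝ) :
    Fin n → ℝ :=
  fun j => x j * vecNorm p (A.col j)

/-- The acceptance ratio
`r_i = n ^ (-(p - 1)) * |∑ j, x_j A_ij| ^ p / ∑ j, |x_j A_ij| ^ p` of row `i`. -/
def acceptRatio {m n : ℕ} (p : ℝ) (A : Matrix (Fin m) (Fin n) ℝ) (x : Fin n → ℝ)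
    (i : Fin m) : ℝ≥0 :=
  Real.toNNReal (|(A *ᵥ x) i| ^ p / ((n : ℝ) ^ (p - 1) * ∑ j, |x j * A i j| ^ p))

/-- For `p ≥ 1` the acceptance ratio is a probability. -/
theorem acceptRatio_le_one {m n : ℕ} {p : ℝ} (hp : 1 ≤ p) (A : Matrix (Fin m) (Fin n) ℝ)
    (x : Fin n → ℝ) (i : Fin m) : acceptRatio p A x i ≤ 1 := by
  rw [acceptRatio, Real.toNNReal_le_one]
  have h1 : |(A *ᵥ x) i| ≤ ∑ j, |x j * A i j| := by
    have h : (A *ᵥ x) i = ∑ j, x j * A i j := by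
      simp [Matrix.mulVec, dotProduct, mul_comm]
    rw [h]
    exact Finset.abs_sum_le_sum_abs _ _
  have h2 : (∑ j, |x j * A i j|) ^ p ≤ (n : ℝ) ^ (p - 1) * ∑ j, |x j * A i j| ^ p := by
    simpa using Real.rpow_sum_le_const_mul_sum_rpow Finset.univ (fun j => x j * A i j) hp
  refine div_le_one_of_le₀ ?_ (by positivity)
  exact (Real.rpow_le_rpow (abs_nonneg _) h1 (by linarith)).trans h2

/-- A biased coin that shows `true` with probability `min r 1`. -/
def coin (r : ℝ≥0) : PMF Bool :=
  PMF.ofFintype (fun b => if b then ((min r 1 : ℝ≥0) : ℝ≥0∞) else 1 - ((min r 1 : ℝ≥0) : ℝ≥0∞))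
    (by simp)

/-- One iteration of the rejection sampler for `D_{Ax}^{(p)}` that uses the data structure
`SQ_p(A)` and query access to `x`.
It draws a column `j` with probability proportional to `‖x_j A^{(j)}‖_p ^ p`, draws a row `i` from
`D_{A^{(j)}}^{(p)}`, and outputs `some i` with probability `r_i`, otherwise `none` (rejection).
By `acceptRatio_le_one`, the truncation at `1` inside `coin` has no effect when `p ≥ 1`. -/
def iteration {m n : ℕ} (p : ℝ) (A : Matrix (Fin m) (Fin n) ℝ) (x : Fin n → ℝ) :
    PMF (Option (Fin m)) :=
  (drawIndex p (weightedColumnNorms p A x)).bind fun col =>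
    match col with
    | none => PMF.pure none
    | some j =>
      (drawIndex p (A.col j)).bind fun row =>
        match row with
        | none => PMF.pure none
        | some i => (coin (acceptRatio p A x i)).map fun accepted =>
            if accepted then some i else none

/-- The discrete sigma-algebra on the finite set of outcomes of an iteration. -/
instance instMeasurableSpaceOutcome (m : ℕ) : MeasurableSpace (Option (Fin m)) := ⊤

/-- The law of an infinite sequence of independent iterations. -/
def runLaw {m n : ℕ} (p : ℝ) (A : Matrix (Fin m) (Fin n) ℝ) (x : Fin n → ℝ) :
    Measure (ℕ → Option (Fin m)) :=
  Measure.infinitePi fun _ => (iteration p A x).toMeasure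

/-- The number of iterations up to and including the first one that outputs a sample
(`∞` if there is none). -/
def iterationsUsed {m : ℕ} (run : ℕ → Option (Fin m)) : ℝ≥0∞ :=
  ⨅ (k : ℕ) (_ : run k ≠ none), ((k : ℝ≥0∞) + 1)

/-- The number of accesses made by one iteration: `n` queries for the entries of `x`, `n` queries
for the stored column norms `‖A^{(j)}‖_p ^ p`, one sample access to a column of `A`, and `n` queries
for the entries of the row `A_i` that enter the acceptance ratio. -/
def queriesPerIteration (n : ℕ) : ℕ := 3 * n + 1

/-- Expected number of iterations for one sample from `D_{Ax}^{(p)}`, for given `A` and `x`. -/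
def expectedIterations {m n : ℕ} (p : ℝ) (A : Matrix (Fin m) (Fin n) ℝ) (x : Fin n → ℝ) : ℝ≥0∞ :=
  ∫⁻ run, iterationsUsed run ∂(runLaw p A x)

/-- Expected number of queries for one sample from `D_{Ax}^{(p)}`, for given `A` and `x`. -/
def expectedQueries {m n : ℕ} (p : ℝ) (A : Matrix (Fin m) (Fin n) ℝ) (x : Fin n → ℝ) : ℝ≥0∞ :=
  ∫⁻ run, (queriesPerIteration n : ℝ≥0∞) * iterationsUsed run ∂(runLaw p A x)

/-- The `m * n` entries of the random matrix `A` and the `n` entries of the random vector `x` are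
jointly independent and all have distribution `ν`. -/
structure IIDEntries {Ω : Type*} [MeasurableSpace Ω] (P : Measure Ω) (ν : Measure ℝ) {m n : ℕ}
    (A : Ω → Matrix (Fin m) (Fin n) ℝ) (x : Ω → Fin n → ℝ) : Prop where
  law_matrix : ∀ i j, HasLaw (fun ω => A ω i j) ν P
  law_vector : ∀ j, HasLaw (fun ω => x ω j) ν P
  indep : iIndepFun (fun (e : (Fin m × Fin n) ⊕ Fin n) (ω : Ω) =>
    Sum.elim (fun ij => A ω ij.1 ij.2) (fun j => x ω j) e) P

/-- The average of `F (A, x)` over the random instances `(A, x)` for which the target distribution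
`D_{Ax}^{(p)}` exists, i.e. `E[F(A, x) | Ax ≠ 0]`. When the entries have a probability density,
`Ax ≠ 0` holds almost surely and this is `E[F(A, x)]`. -/
def instanceAverage {Ω : Type*} [MeasurableSpace Ω] (P : Measure Ω) {m n : ℕ}
    (A : Ω → Matrix (Fin m) (Fin n) ℝ) (x : Ω → Fin n → ℝ)
    (F : Matrix (Fin m) (Fin n) ℝ → (Fin n → ℝ) → ℝ≥0∞) : ℝ≥0∞ :=
  ∫⁻ ω, F (A ω) (x ω) ∂(P[|{ω | A ω *ᵥ x ω ≠ 0}])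

end

end LpSampling

namespace LpSampling

open Filter Topology

/-! An iteration outputs `i` with probability `|(Ax)_i|^p / (n^(p-1) W_p)`, where `W_p` is
`entrySum`. With `V_p = ‖Ax‖_p^p`, which is `imageSum`, the waiting time is geometric with mean `R_p
= n^(p-1) W_p / V_p`, which is `costRatio`. Since `R_p` is `0` when `Ax = 0`, conditioning on `Ax ≠
0` only divides every mean by the same probability. It remains to compare `E R_1` with `E R_p` over
product measures.

No density is assumed and `V_1` may be tiny, so `E R_1` need not be finite a priori. The upper bound
(`exists_lintegral_costRatio_one_le`) is therefore relative: `E R_1 ≤ C √n + n^((1-p)/2) E R_p`.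
Where `R_1 ≥ m √n`, the power mean inequality and `‖·‖_p ≤ ‖·‖_1` give `R_1 ≤ n^((1-p)/2) R_p`
pointwise. Where `R_1 < m √n` but `‖Ax‖_1 ≤ η m ‖x‖_2`, a probability `O(1/m)` compensates the
factor `m`. Elsewhere `R_1 ≤ W_1 / (η m ‖x‖_2)`, whose mean is `O(√n)` because `‖x‖_1 ≤ √n ‖x‖_2`.
The probability estimate is a Chernoff bound over the rows for fixed `x`, fed by a characteristic
function bound uniform in `x` (`exists_integral_exp_neg_abs_le`).

The lower bound (`exists_le_lintegral_costRatio`) is `E R_p ≥ c n^(θ/2)` with `θ > 1` for `p > 1`,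
and `θ = 2` for `p = 2`. With probability bounded below, `W_1` is of order `m n` (second moment
method), `V_p` is at most of order `m n^(p-θ/2)` (Markov), and `V_p ≠ 0`. The input is a moment
bound for sums of independent centred variables (`exists_lintegral_enorm_sum_rpow_le`).

For large `n`, `n^(θ/2)` dominates `√n` and `n^((1-p)/2) ≤ 1/2`, which gives (a); for `p = 2` both
terms of the upper bound are `O(1/√n) E R_2`, which gives (b). -/

/-- The sum `∑ i j, |x j * a i j| ^ p`, that is `∑ j, ‖x j • a^{(j)}‖_p ^ p`. -/
noncomputable def entrySum {m n : ℕ} (p : ℝ) (a : Fin m → Fin n → ℝ) (x : Fin n → ℝ) : ℝ :=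
  ∑ i, ∑ j, |x j * a i j| ^ p

/-- The sum `∑ i, |∑ j, x j * a i j| ^ p`, that is `‖a x‖_p ^ p`. -/
noncomputable def imageSum {m n : ℕ} (p : ℝ) (a : Fin m → Fin n → ℝ) (x : Fin n → ℝ) : ℝ :=
  ∑ i, |∑ j, x j * a i j| ^ p

/-- The closed form of the expected number of iterations. It vanishes when `a x = 0`. -/
noncomputable def costRatio {m n : ℕ} (p : ℝ) (a : Fin m → Fin n → ℝ) (x : Fin n → ℝ) : ℝ :=
  (n : ℝ) ^ (p - 1) * entrySum p a x / imageSum p a x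

/-! ### Closed form of the expected number of iterations -/

theorem entrySum_nonneg {m n : ℕ} (p : ℝ) (a : Fin m → Fin n → ℝ) (x : Fin n → ℝ) :
    0 ≤ entrySum p a x := by
  unfold entrySum; positivity

theorem imageSum_nonneg {m n : ℕ} (p : ℝ) (a : Fin m → Fin n → ℝ) (x : Fin n → ℝ) :
    0 ≤ imageSum p a x := by
  unfold imageSum; positivity

/-- Tail-sum formula: the `k`-th term indicates that the first `k` iterations all reject. It stays
valid for runs that never accept, and integration turns it into a geometric series. -/
theorem iterationsUsed_eq_tsum {m : ℕ} (run : ℕ → Option (Fin m)) :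
    iterationsUsed run =
      ∑' k : ℕ, (Set.pi (Finset.range k : Set ℕ) fun _ => ({none} : Set (Option (Fin m)))).indicator
        (fun _ => (1 : ℝ≥0∞)) run := by
  classical
  by_cases h : ∃ k, run k ≠ none
  · have hmem : ∀ k, run ∈ (Set.pi (Finset.range k : Set ℕ)
        fun _ => ({none} : Set (Option (Fin m)))) ↔ k < Nat.find h + 1 := by
      intro k
      simp only [Set.mem_pi, Finset.coe_range, Set.mem_Iio, Set.mem_singleton_iff]
      constructor
      · intro hk
        by_contra hlt
        exact Nat.find_spec h (hk _ (by omega))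
      · intro hk j hj
        by_contra hne
        exact Nat.find_min h (by omega) hne
    rw [tsum_eq_sum (s := Finset.range (Nat.find h + 1))]
    · rw [Finset.sum_congr rfl fun k hk =>
        Set.indicator_of_mem ((hmem k).2 (Finset.mem_range.1 hk)) _]
      simp only [Finset.sum_const, Finset.card_range, nsmul_eq_mul, mul_one, Nat.cast_add,
        Nat.cast_one]
      refine le_antisymm (iInf₂_le (Nat.find h) (Nat.find_spec h)) (le_iInf₂ fun k hk => ?_)
      gcongr
      exact Nat.find_min' h hk
    · intro k hk
      exact Set.indicator_of_notMem (fun hm => hk (Finset.mem_range.2 ((hmem k).1 hm))) _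
  · push Not at h
    have : ∀ k : ℕ, (Set.pi (Finset.range k : Set ℕ)
        fun _ => ({none} : Set (Option (Fin m)))).indicator (fun _ => (1 : ℝ≥0∞)) run = 1 :=
      fun k => Set.indicator_of_mem (a := run)
        (Set.mem_pi.2 fun j _ => Set.mem_singleton_iff.2 (h j)) _
    simp_rw [this, ENNReal.tsum_const_eq_top_of_ne_zero one_ne_zero]
    simp [iterationsUsed, h]

theorem expectedIterations_eq_geometric {m n : ℕ} (p : ℝ) (A : Matrix (Fin m) (Fin n) ℝ)
    (x : Fin n → ℝ) : expectedIterations p A x = (1 - iteration p A x none)⁻¹ := by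
  have hset : ∀ k : ℕ, MeasurableSet (Set.pi (Finset.range k : Set ℕ)
      fun _ => ({none} : Set (Option (Fin m)))) := fun k =>
    MeasurableSet.pi (Finset.countable_toSet _) fun _ _ => MeasurableSpace.measurableSet_top
  have : ∀ k : ℕ, runLaw p A x (Set.pi (Finset.range k : Set ℕ)
      fun _ => ({none} : Set (Option (Fin m)))) = iteration p A x none ^ k := by
    intro k
    rw [runLaw, Measure.infinitePi_pi _ fun _ _ => MeasurableSpace.measurableSet_top]
    simp [PMF.toMeasure_apply_singleton _ _ MeasurableSpace.measurableSet_top]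
  simp_rw [expectedIterations, iterationsUsed_eq_tsum]
  rw [lintegral_tsum fun k => (measurable_const.indicator (hset k)).aemeasurable]
  simp_rw [lintegral_indicator_const (hset _), this, one_mul, ENNReal.tsum_geometric]

theorem expectedQueries_eq {m n : ℕ} (p : ℝ) (A : Matrix (Fin m) (Fin n) ℝ) (x : Fin n → ℝ) :
    expectedQueries p A x = (queriesPerIteration n : ℝ≥0∞) * expectedIterations p A x :=
  lintegral_const_mul' _ _ (ENNReal.natCast_ne_top _)

theorem one_sub_iteration_none {m n : ℕ} (p : ℝ) (A : Matrix (Fin m) (Fin n) ℝ) (x : Fin n → ℝ) :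
    1 - iteration p A x none = ∑ i, iteration p A x (some i) := by
  have h := (iteration p A x).tsum_coe
  rw [tsum_fintype, Fintype.sum_option] at h
  rw [← h, ENNReal.add_sub_cancel_left (PMF.apply_ne_top _ _)]

theorem lpDist_apply {k : ℕ} (p : ℝ) (v : Fin k → ℝ) (hv : v ≠ 0) (i : Fin k) :
    lpDist p v hv i = ENNReal.ofReal (|v i| ^ p / ∑ j, |v j| ^ p) := by
  obtain ⟨l, hl⟩ := Function.ne_iff.mp hv
  have hpos : 0 < ∑ j, |v j| ^ p :=
    Finset.sum_pos' (fun j _ => by positivity)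
      ⟨l, Finset.mem_univ _, Real.rpow_pos_of_pos (abs_pos.mpr hl) p⟩
  rw [lpDist, PMF.normalize_apply, tsum_fintype, ENNReal.ofReal_div_of_pos hpos,
    ENNReal.ofReal_sum_of_nonneg fun j _ => by positivity, div_eq_mul_inv]

theorem coin_map_apply_some {m : ℕ} {r : ℝ≥0} (hr : r ≤ 1) (i i' : Fin m) :
    (coin r).map (fun accepted => if accepted then some i' else none) (some i) =
      if i = i' then (r : ℝ≥0∞) else 0 := by
  rw [PMF.map_apply, tsum_fintype]
  simp [coin, hr]

theorem weightedColumnNorms_rpow {m n : ℕ} {p : ℝ} (hp : 1 ≤ p) (A : Matrix (Fin m) (Fin n) ℝ)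
    (x : Fin n → ℝ) (j : Fin n) :
    |weightedColumnNorms p A x j| ^ p = ∑ i, |x j * A i j| ^ p := by
  have h0 : 0 ≤ ∑ i, |A i j| ^ p := by positivity
  have hv : vecNorm p (A.col j) = (∑ i, |A i j| ^ p) ^ (1 / p) := rfl
  rw [weightedColumnNorms, hv, abs_mul, Real.mul_rpow (abs_nonneg _) (abs_nonneg _),
    abs_of_nonneg (Real.rpow_nonneg h0 _), ← Real.rpow_mul h0, one_div_mul_cancel (by linarith),
    Real.rpow_one, Finset.mul_sum]
  refine Finset.sum_congr rfl fun i _ => ?_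
  rw [abs_mul, Real.mul_rpow (abs_nonneg _) (abs_nonneg _)]

/-- The column norms cancel between the two draws, so row `i` is proposed with probability `(∑ j,
|x_j A_ij|^p) / W_p`; the denominator of the acceptance ratio then removes the row sum. -/
theorem iteration_some {m n : ℕ} {p : ℝ} (hp : 1 ≤ p) (A : Matrix (Fin m) (Fin n) ℝ)
    (x : Fin n → ℝ) (hAx : A *ᵥ x ≠ 0) (i : Fin m) :
    iteration p A x (some i) =
      ENNReal.ofReal (|∑ j, x j * A i j| ^ p / ((n : ℝ) ^ (p - 1) * entrySum p A x)) := by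
  have hp0 : p ≠ 0 := by linarith
  have hmul : ∀ i, (A *ᵥ x) i = ∑ j, x j * A i j := fun i => by
    simp [Matrix.mulVec, dotProduct, mul_comm]
  obtain ⟨i₀, hi₀⟩ := Function.ne_iff.mp hAx
  rw [hmul] at hi₀
  obtain ⟨j₀, -, hj₀⟩ := Finset.exists_ne_zero_of_sum_ne_zero hi₀
  have hW : ∑ j, |weightedColumnNorms p A x j| ^ p = entrySum p A x := by
    simp_rw [weightedColumnNorms_rpow hp, entrySum]
    exact Finset.sum_comm
  have hwj : ∀ i j, x j * A i j ≠ 0 → weightedColumnNorms p A x j ≠ 0 := by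
    intro i j hij h0
    have h := weightedColumnNorms_rpow hp A x j
    rw [h0, abs_zero, Real.zero_rpow hp0, eq_comm,
      Finset.sum_eq_zero_iff_of_nonneg fun _ _ => by positivity] at h
    exact absurd (h i (Finset.mem_univ _)) (Real.rpow_pos_of_pos (abs_pos.2 hij) p).ne'
  have hw : weightedColumnNorms p A x ≠ 0 := fun h => hwj _ _ hj₀ (congrFun h j₀)
  -- A zero column, for which the second draw fails, has weight zero in the first draw, so the
  -- formula holds for it too.
  have key : ∀ j, lpDist p _ hw j * ((drawIndex p (A.col j)).bind fun row =>
        match row with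
        | none => PMF.pure none
        | some i => (coin (acceptRatio p A x i)).map fun accepted =>
            if accepted then some i else none) (some i) =
      ENNReal.ofReal (|x j * A i j| ^ p / entrySum p A x) * acceptRatio p A x i := by
    intro j
    by_cases hc : A.col j = 0
    · have hA : ∀ i, A i j = 0 := fun i => congrFun hc i
      rw [lpDist_apply, weightedColumnNorms_rpow hp]
      simp [hA, Real.zero_rpow hp0]
    · have hsum : 0 < ∑ i, |A i j| ^ p := by
        obtain ⟨l, hl⟩ := Function.ne_iff.mp hc
        exact Finset.sum_pos' (fun j _ => by positivity)
          ⟨l, Finset.mem_univ _, Real.rpow_pos_of_pos (abs_pos.mpr hl) p⟩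
      rw [drawIndex, dif_pos hc, PMF.bind_map, PMF.bind_apply, tsum_fintype,
        Finset.sum_eq_single i]
      · simp only [Function.comp_apply]
        rw [coin_map_apply_some (acceptRatio_le_one hp A x i), if_pos rfl, ← mul_assoc,
          lpDist_apply, lpDist_apply, hW, weightedColumnNorms_rpow hp,
          ← ENNReal.ofReal_mul (div_nonneg (by positivity) (entrySum_nonneg p A x))]
        congr 2
        have h1 : ∀ i, |x j * A i j| ^ p = |x j| ^ p * |A i j| ^ p := fun i => by
          rw [abs_mul, Real.mul_rpow (abs_nonneg _) (abs_nonneg _)]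
        simp_rw [h1, ← Finset.mul_sum]
        change _ / _ * (|A i j| ^ p / ∑ i, |A i j| ^ p) = _
        field_simp
      · intro i' _ hne
        simp only [Function.comp_apply]
        rw [coin_map_apply_some (acceptRatio_le_one hp A x i'), if_neg hne.symm, mul_zero]
      · simp
  rw [iteration, drawIndex, dif_pos hw, PMF.bind_map, PMF.bind_apply, tsum_fintype]
  simp only [Function.comp_apply]
  refine (Finset.sum_congr rfl fun j _ => key j).trans ?_
  rw [← Finset.sum_mul,
    ← ENNReal.ofReal_sum_of_nonneg fun j _ => div_nonneg (by positivity) (entrySum_nonneg p A x),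
    ← Finset.sum_div, acceptRatio, hmul]
  have hr : (Real.toNNReal (|∑ j, x j * A i j| ^ p /
      ((n : ℝ) ^ (p - 1) * ∑ j, |x j * A i j| ^ p)) : ℝ≥0∞) =
      ENNReal.ofReal (|∑ j, x j * A i j| ^ p / ((n : ℝ) ^ (p - 1) * ∑ j, |x j * A i j| ^ p)) := rfl
  rw [hr, ← ENNReal.ofReal_mul (div_nonneg (by positivity) (entrySum_nonneg p A x))]
  congr 1
  -- On a vanishing row the acceptance ratio is `0 / 0 = 0`, in agreement with the numerator
  -- `|(Ax)_i|^p = 0`.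
  by_cases hrow : ∑ j, |x j * A i j| ^ p = 0
  · have h0 : ∀ j, x j * A i j = 0 := by
      intro j
      rw [Finset.sum_eq_zero_iff_of_nonneg fun _ _ => by positivity] at hrow
      have := hrow j (Finset.mem_univ _)
      rwa [Real.rpow_eq_zero (abs_nonneg _) hp0, abs_eq_zero] at this
    simp [h0, Real.zero_rpow hp0]
  · by_cases hn : (n : ℝ) ^ (p - 1) = 0
    · simp [hn]
    · rw [div_mul_div_comm, mul_comm ((n : ℝ) ^ (p - 1)) (∑ j, _), mul_left_comm,
        mul_div_mul_left _ _ hrow, mul_comm (entrySum p A x)]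

theorem imageSum_pos {m n : ℕ} {p : ℝ} {a : Fin m → Fin n → ℝ} {x : Fin n → ℝ}
    (h : (a : Matrix (Fin m) (Fin n) ℝ) *ᵥ x ≠ 0) : 0 < imageSum p a x := by
  obtain ⟨i, hi⟩ := Function.ne_iff.mp h
  have hmul : ((a : Matrix (Fin m) (Fin n) ℝ) *ᵥ x) i = ∑ j, x j * a i j := by
    simp [Matrix.mulVec, dotProduct, mul_comm]
  rw [hmul] at hi
  exact Finset.sum_pos' (fun j _ => by positivity)
    ⟨i, Finset.mem_univ _, Real.rpow_pos_of_pos (abs_pos.mpr hi) p⟩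

theorem expectedIterations_eq_costRatio {m n : ℕ} {p : ℝ} (hp : 1 ≤ p)
    (A : Matrix (Fin m) (Fin n) ℝ) (x : Fin n → ℝ) (hAx : A *ᵥ x ≠ 0) :
    expectedIterations p A x = ENNReal.ofReal (costRatio p A x) := by
  have hV : 0 < imageSum p A x := imageSum_pos hAx
  rw [expectedIterations_eq_geometric, one_sub_iteration_none,
    Finset.sum_congr rfl fun i _ => iteration_some hp A x hAx i,
    ← ENNReal.ofReal_sum_of_nonneg fun i _ => div_nonneg (by positivity)
      (mul_nonneg (by positivity) (entrySum_nonneg p A x)), ← Finset.sum_div]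
  change (ENNReal.ofReal (imageSum p A x / _))⁻¹ = _
  -- The power mean inequality in each row bounds `V_p` by this quantity, so it inherits positivity.
  have hW : 0 < (n : ℝ) ^ (p - 1) * entrySum p A x := by
    refine lt_of_lt_of_le hV ?_
    change ∑ i, |∑ j, x j * A i j| ^ p ≤ (n : ℝ) ^ (p - 1) * ∑ i, ∑ j, |x j * A i j| ^ p
    rw [Finset.mul_sum]
    refine Finset.sum_le_sum fun i _ => ?_
    refine (Real.rpow_le_rpow (abs_nonneg _) (Finset.abs_sum_le_sum_abs _ _)
      (by linarith)).trans ?_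
    simpa using Real.rpow_sum_le_const_mul_sum_rpow Finset.univ (fun j => x j * A i j) hp
  rw [← ENNReal.ofReal_inv_of_pos (div_pos hV hW), inv_div]
  rfl

theorem costRatio_eq_zero {m n : ℕ} {p : ℝ} (hp : 1 ≤ p)
    (a : Fin m → Fin n → ℝ) (x : Fin n → ℝ)
    (h : (a : Matrix (Fin m) (Fin n) ℝ) *ᵥ x = 0) : costRatio p a x = 0 := by
  have hmul : ∀ i, ((a : Matrix (Fin m) (Fin n) ℝ) *ᵥ x) i = ∑ j, x j * a i j := fun i => by
    simp [Matrix.mulVec, dotProduct, mul_comm]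
  have : imageSum p a x = 0 := by
    simp [imageSum, ← hmul, h, Real.zero_rpow (show p ≠ 0 by linarith)]
  rw [costRatio, this, div_zero]

/-! ### Anti-concentration of linear forms and of `‖a x‖₁` -/

/-- The characteristic function of a centred law with positive second moment has modulus bounded
away from one, quadratically in `t`, near the origin. -/
theorem exists_norm_charFun_le {ν : Measure ℝ} [IsProbabilityMeasure ν]
    (hmean : ∫ t, t ∂ν = 0) (hvar : MemLp (fun t : ℝ => t) 2 ν) (hpos : 0 < ∫ t, t ^ 2 ∂ν) :
    ∃ c > 0, ∃ δ > 0, ∀ t : ℝ, |t| ≤ δ → ‖charFun ν t‖ ≤ 1 - c * t ^ 2 := by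
  set s := ∫ t, t ^ 2 ∂ν with hs
  have htaylor : (fun t => charFun ν t - (1 - s * t ^ 2 / 2)) =o[𝓝 0] fun t : ℝ => t ^ 2 := by
    have h1 := taylor_isLittleO_univ (contDiff_charFun (μ := ν) (n := 2) hvar) (x₀ := (0 : ℝ))
    have h2 : ∀ t, taylorWithinEval (charFun ν) 2 Set.univ 0 t = 1 - s * t ^ 2 / 2 := by
      intro t
      have := taylorWithinEval_charFun_two_zero (P := ν) (X := id) aemeasurable_id
        (by rw [Measure.map_id]; exact hvar) t
      rw [Measure.map_id] at this
      rw [this]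
      simp [hmean, hs]
    simp_rw [h2] at h1
    simpa using h1
  have hs4 : 0 < s / 4 := by positivity
  have h1 := htaylor.bound hs4
  have h2 : ∀ᶠ t : ℝ in 𝓝 0, s * t ^ 2 / 2 < 1 := by
    have : Tendsto (fun t : ℝ => s * t ^ 2 / 2) (𝓝 0) (𝓝 (s * 0 ^ 2 / 2)) :=
      Continuous.tendsto (by fun_prop) 0
    refine this.eventually_lt_const ?_
    norm_num
  obtain ⟨δ, hδ, hball⟩ := Metric.eventually_nhds_iff.1 (h1.and h2)
  -- The quadratic term `s t² / 2` loses half of itself to the Taylor error, which leaves `s / 4`.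
  -- Halving `δ` passes from an open ball to a closed one.
  refine ⟨s / 4, hs4, δ / 2, by positivity, fun t ht => ?_⟩
  obtain ⟨h3, h4⟩ := hball (y := t) (by rw [Real.dist_eq, sub_zero]; linarith)
  have h5 : ‖(1 - (s : ℂ) * (t : ℂ) ^ 2 / 2)‖ = 1 - s * t ^ 2 / 2 := by
    have : (1 - (s : ℂ) * (t : ℂ) ^ 2 / 2) = ((1 - s * t ^ 2 / 2 : ℝ) : ℂ) := by push_cast; ring
    rw [this, Complex.norm_real, Real.norm_of_nonneg (by linarith)]
  have h6 := norm_add_le (charFun ν t - (1 - (s : ℂ) * (t : ℂ) ^ 2 / 2))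
    (1 - (s : ℂ) * (t : ℂ) ^ 2 / 2)
  rw [sub_add_cancel, h5] at h6
  rw [Real.norm_of_nonneg (sq_nonneg t)] at h3
  linarith

/-- If `exp (-|u|)` has mean close to one, so does `exp (iu)`; this transfers a bound on a
characteristic function to a Laplace transform. -/
theorem norm_one_sub_exp_le (u : ℝ) :
    ‖1 - Complex.exp (Complex.I * u)‖ ≤ 3 * (1 - Real.exp (-|u|)) := by
  have h1 : ‖1 - Complex.exp (Complex.I * u)‖ ≤ |u| := by
    rw [norm_sub_rev]; exact Real.norm_exp_I_mul_ofReal_sub_one_le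
  have h2 : ‖1 - Complex.exp (Complex.I * u)‖ ≤ 2 := by
    refine (norm_sub_le _ _).trans ?_
    rw [mul_comm, Complex.norm_exp_ofReal_mul_I]
    norm_num
  have h3 : Real.exp (-|u|) ≤ 1 / (1 + |u|) := by
    rw [Real.exp_neg, ← one_div]
    exact one_div_le_one_div_of_le (by positivity) (by linarith [Real.add_one_le_exp |u|])
  have h0 := abs_nonneg u
  -- The right side is `3|u| / (1 + |u|)`, which equals `2` at `|u| = 2`; this fixes the constant
  -- `3`.
  have h4 : min |u| 2 ≤ 3 * (1 - 1 / (1 + |u|)) := by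
    have : 3 * (1 - 1 / (1 + |u|)) = 3 * |u| / (1 + |u|) := by field_simp; ring
    rw [this, le_div_iff₀ (by positivity)]
    rcases le_total |u| 2 with h | h
    · rw [min_eq_left h]; nlinarith
    · rw [min_eq_right h]; nlinarith
  linarith [le_min h1 h2]

/-- The Euclidean norm of a vector of reals. -/
noncomputable def euclid {n : ℕ} (x : Fin n → ℝ) : ℝ := √(∑ j, x j ^ 2)

theorem euclid_nonneg {n : ℕ} (x : Fin n → ℝ) : 0 ≤ euclid x := Real.sqrt_nonneg _

theorem euclid_sq {n : ℕ} (x : Fin n → ℝ) : euclid x ^ 2 = ∑ j, x j ^ 2 :=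
  Real.sq_sqrt (by positivity)

theorem euclid_pos {n : ℕ} {x : Fin n → ℝ} (hx : x ≠ 0) : 0 < euclid x := by
  obtain ⟨j, hj⟩ := Function.ne_iff.mp hx
  exact Real.sqrt_pos.2 (Finset.sum_pos' (fun j _ => sq_nonneg _)
    ⟨j, Finset.mem_univ _, by have : x j ≠ 0 := hj; positivity⟩)

theorem abs_le_euclid {n : ℕ} (x : Fin n → ℝ) (j : Fin n) : |x j| ≤ euclid x :=
  Real.abs_le_sqrt (Finset.single_le_sum (f := fun j => x j ^ 2) (fun _ _ => sq_nonneg _)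
    (Finset.mem_univ j))

/-- A linear form in independent centred variables is not concentrated near zero, at the scale of
the Euclidean norm of its coefficients and uniformly in these coefficients. -/
theorem exists_integral_exp_neg_abs_le {ν : Measure ℝ} [IsProbabilityMeasure ν]
    (hmean : ∫ t, t ∂ν = 0) (hvar : MemLp (fun t : ℝ => t) 2 ν) (hpos : 0 < ∫ t, t ^ 2 ∂ν) :
    ∃ δ > 0, ∃ κ > 0, ∀ (n : ℕ) (x : Fin n → ℝ), x ≠ 0 →
      ∫ b, Real.exp (-(δ / euclid x * |∑ j, x j * b j|)) ∂(Measure.pi fun _ : Fin n => ν) ≤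
        Real.exp (-κ) := by
  obtain ⟨c, hc, δ, hδ, hφ⟩ := exists_norm_charFun_le hmean hvar hpos
  have hlt : Real.exp (-(c * δ ^ 2)) < 1 := by
    rw [Real.exp_lt_one_iff]
    have := mul_pos hc (pow_pos hδ 2)
    linarith
  refine ⟨δ, hδ, (1 - Real.exp (-(c * δ ^ 2))) / 3, by linarith, fun n x hx => ?_⟩
  set π := Measure.pi fun _ : Fin n => ν
  set t := δ / euclid x with ht
  have hx0 := euclid_pos hx
  have ht0 : 0 < t := by positivity
  have hΦ : ∫ b, Complex.exp (Complex.I * ((t * ∑ j, x j * b j : ℝ) : ℂ)) ∂π =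
      ∏ j, charFun ν (t * x j) := by
    have h := integral_fintype_prod_eq_prod (𝕜 := ℂ) (μ := fun _ : Fin n => ν)
      fun (j : Fin n) (b : ℝ) => Complex.exp ((t * x j : ℝ) * b * Complex.I)
    simp_rw [charFun_apply_real]
    rw [← h]
    refine integral_congr_ae (Eventually.of_forall fun b => ?_)
    simp only
    rw [← Complex.exp_sum]
    congr 1
    push_cast
    rw [Finset.mul_sum, Finset.mul_sum]
    exact Finset.sum_congr rfl fun j _ => by ring
  -- The scaling `t = δ / ‖x‖₂` keeps every argument `t x_j` within `δ` and makes the squares `(t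
  -- x_j)²` sum to exactly `δ²`, whatever `n` and `x` are.
  have hΦle : ‖∏ j, charFun ν (t * x j)‖ ≤ Real.exp (-(c * δ ^ 2)) := by
    rw [norm_prod]
    have hsum : c * δ ^ 2 = ∑ j, c * (t * x j) ^ 2 := by
      rw [← Finset.mul_sum]
      simp_rw [mul_pow]
      rw [← Finset.mul_sum, ← euclid_sq, ht, div_pow, div_mul_cancel₀ _ (by positivity)]
    rw [hsum, ← Finset.sum_neg_distrib, Real.exp_sum]
    refine Finset.prod_le_prod (fun _ _ => norm_nonneg _) fun j _ => ?_
    refine (hφ _ ?_).trans ?_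
    · rw [abs_mul, abs_of_pos ht0, ht, div_mul_eq_mul_div, div_le_iff₀ hx0]
      exact mul_le_mul_of_nonneg_left (abs_le_euclid x j) hδ.le
    · linarith [Real.add_one_le_exp (-(c * (t * x j) ^ 2))]
  have hexpint : Integrable (fun b : Fin n → ℝ => Real.exp (-(t * |∑ j, x j * b j|))) π := by
    refine Integrable.of_bound (C := 1)
      (Measurable.aestronglyMeasurable (by fun_prop)) (Eventually.of_forall fun b => ?_)
    rw [Real.norm_of_nonneg (Real.exp_pos _).le, Real.exp_le_one_iff]
    have := mul_nonneg ht0.le (abs_nonneg (∑ j, x j * b j))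
    linarith
  have hcint : Integrable
      (fun b : Fin n → ℝ => Complex.exp (Complex.I * ((t * ∑ j, x j * b j : ℝ) : ℂ))) π := by
    refine Integrable.of_bound (C := 1)
      (Measurable.aestronglyMeasurable (by fun_prop)) (Eventually.of_forall fun b => ?_)
    rw [mul_comm, Complex.norm_exp_ofReal_mul_I]
  have h1 : ‖1 - ∏ j, charFun ν (t * x j)‖ ≤
      3 * (1 - ∫ b, Real.exp (-(t * |∑ j, x j * b j|)) ∂π) := by
    have e1 : (1 : ℂ) - ∏ j, charFun ν (t * x j) =
        ∫ b, (1 - Complex.exp (Complex.I * ((t * ∑ j, x j * b j : ℝ) : ℂ))) ∂π := by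
      rw [integral_sub (integrable_const _) hcint, hΦ]; simp
    have e2 : 3 * (1 - ∫ b, Real.exp (-(t * |∑ j, x j * b j|)) ∂π) =
        ∫ b, 3 * (1 - Real.exp (-(t * |∑ j, x j * b j|))) ∂π := by
      rw [integral_const_mul, integral_sub (integrable_const _) hexpint]; simp
    rw [e1, e2]
    refine norm_integral_le_of_norm_le (((integrable_const _).sub hexpint).const_mul 3)
      (Eventually.of_forall fun b => ?_)
    refine (norm_one_sub_exp_le _).trans_eq ?_
    rw [abs_mul, abs_of_pos ht0]
  have h2 : 1 - ‖∏ j, charFun ν (t * x j)‖ ≤ ‖1 - ∏ j, charFun ν (t * x j)‖ := by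
    simpa using norm_sub_norm_le (1 : ℂ) (∏ j, charFun ν (t * x j))
  linarith [Real.add_one_le_exp (-((1 - Real.exp (-(c * δ ^ 2))) / 3))]

theorem imageSum_one {m n : ℕ} (a : Fin m → Fin n → ℝ) (x : Fin n → ℝ) :
    imageSum 1 a x = ∑ i, |∑ j, x j * a i j| := by
  simp [imageSum]

theorem entrySum_one {m n : ℕ} (a : Fin m → Fin n → ℝ) (x : Fin n → ℝ) :
    entrySum 1 a x = ∑ i, ∑ j, |x j * a i j| := by
  simp [entrySum]

/-- For a fixed vector `x ≠ 0`, the probability that `‖a x‖₁` is much smaller than `m ‖x‖₂` is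
`O(1 / m)`, uniformly in `x`. -/
theorem exists_measure_imageSum_le {ν : Measure ℝ} [IsProbabilityMeasure ν]
    (hmean : ∫ t, t ∂ν = 0) (hvar : MemLp (fun t : ℝ => t) 2 ν) (hpos : 0 < ∫ t, t ^ 2 ∂ν) :
    ∃ η > 0, ∃ C > 0, ∀ (m n : ℕ) (x : Fin n → ℝ), 0 < m → x ≠ 0 →
      (Measure.pi fun _ : Fin m => Measure.pi fun _ : Fin n => ν)
        {a | imageSum 1 a x ≤ η * m * euclid x} ≤ ENNReal.ofReal (C / m) := by
  obtain ⟨δ, hδ, κ, hκ, hexp⟩ := exists_integral_exp_neg_abs_le hmean hvar hpos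
  refine ⟨κ / (2 * δ), by positivity, 2 / κ, by positivity, fun m n x hm hx => ?_⟩
  set π := Measure.pi fun _ : Fin n => ν
  have hx0 := euclid_pos hx
  have hm0 : (0 : ℝ) < m := by exact_mod_cast hm
  set t := δ / euclid x with ht
  have ht0 : 0 < t := by positivity
  have hprod : ∀ a : Fin m → Fin n → ℝ, Real.exp (-t * imageSum 1 a x) =
      ∏ i, Real.exp (-(t * |∑ j, x j * a i j|)) := fun a => by
    rw [← Real.exp_sum, imageSum_one, Finset.sum_neg_distrib, neg_mul, Finset.mul_sum]
  have hmeas : Measurable fun a : Fin m → Fin n → ℝ => imageSum 1 a x := by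
    simp_rw [imageSum_one]; fun_prop
  -- Chernoff bound for the lower tail: for fixed `x` the rows are independent, so the Laplace
  -- transform is an `m`-th power. The threshold `κ / (2δ)` spends half of the exponent `κ m`.
  have hcher := measure_le_le_exp_mul_mgf (μ := Measure.pi fun _ : Fin m => π)
    (X := fun a => imageSum 1 a x) (κ / (2 * δ) * m * euclid x) (t := -t) (by linarith) (by
      refine Integrable.of_bound (C := 1)
        (Measurable.aestronglyMeasurable (by fun_prop)) (Eventually.of_forall fun a => ?_)
      rw [Real.norm_of_nonneg (Real.exp_pos _).le, Real.exp_le_one_iff]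
      have := mul_nonneg ht0.le (imageSum_nonneg 1 a x)
      linarith)
  have hmgf : mgf (fun a => imageSum 1 a x) (Measure.pi fun _ : Fin m => π) (-t) ≤
      Real.exp (-κ) ^ m := by
    simp_rw [mgf, hprod]
    have := integral_fintype_prod_eq_pow (ι := Fin m) (μ := π)
      fun b : Fin n → ℝ => Real.exp (-(t * |∑ j, x j * b j|))
    rw [this, Fintype.card_fin]
    exact pow_le_pow_left₀ (integral_nonneg fun _ => (Real.exp_pos _).le) (hexp n x hx) m
  rw [← ofReal_measureReal (measure_ne_top _ _)]
  refine ENNReal.ofReal_le_ofReal (hcher.trans ?_)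
  have e1 : -(-t) * (κ / (2 * δ) * m * euclid x) = κ / 2 * m := by
    rw [ht]; field_simp
  rw [e1]
  calc _ ≤ Real.exp (κ / 2 * m) * Real.exp (-κ) ^ m := by gcongr
    _ = Real.exp (-(κ / 2 * m)) := by
      rw [← Real.exp_nat_mul, ← Real.exp_add]; congr 1; ring
    -- Exponential decay is weakened to `1 / m`, which is enough against a cost capped at `m √n`.
    _ ≤ 1 / (κ / 2 * m) := by
      rw [Real.exp_neg, ← one_div]
      exact one_div_le_one_div_of_le (by positivity)
        (by linarith [Real.add_one_le_exp (κ / 2 * m)])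
    _ = 2 / κ / m := by field_simp

/-! ### Moments of sums of independent centred variables -/

theorem lintegral_enorm_rpow_le_of_le {Ω : Type*} [MeasurableSpace Ω] {μ : Measure Ω}
    [IsProbabilityMeasure μ] {f : Ω → ℝ} (hf : AEStronglyMeasurable f μ) {q r : ℝ} (hq : 0 < q)
    (hqr : q ≤ r) : ∫⁻ ω, ‖f ω‖ₑ ^ q ∂μ ≤ (∫⁻ ω, ‖f ω‖ₑ ^ r ∂μ) ^ (q / r) := by
  have h := eLpNorm'_le_eLpNorm'_of_exponent_le hq hqr μ hf
  rw [eLpNorm', eLpNorm'] at h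
  have h2 := ENNReal.rpow_le_rpow h hq.le
  rwa [← ENNReal.rpow_mul, ← ENNReal.rpow_mul, one_div_mul_cancel hq.ne', ENNReal.rpow_one,
    one_div_mul_eq_div] at h2

theorem lintegral_enorm_rpow_ne_top {Ω : Type*} [MeasurableSpace Ω] {μ : Measure Ω} {f : Ω → ℝ}
    {q : ℝ} (hq : 0 < q) (hf : MemLp f (ENNReal.ofReal q) μ) : ∫⁻ ω, ‖f ω‖ₑ ^ q ∂μ ≠ ∞ := by
  have h := lintegral_rpow_enorm_lt_top_of_eLpNorm_lt_top (p := ENNReal.ofReal q)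
    (by simpa using hq) ENNReal.ofReal_ne_top hf.2
  rw [ENNReal.toReal_ofReal hq.le] at h
  exact h.ne

variable {ρ : Measure ℝ} [IsProbabilityMeasure ρ] {n : ℕ}

/-- Additivity of the variance. Partial index sets are allowed because one summand is split off
below. -/
theorem lintegral_enorm_sum_sq (hmean : ∫ t, t ∂ρ = 0) (h2 : MemLp (fun t : ℝ => t) 2 ρ)
    (s : Finset (Fin n)) :
    ∫⁻ y, ‖∑ j ∈ s, y j‖ₑ ^ (2 : ℝ) ∂(Measure.pi fun _ : Fin n => ρ) =
      s.card * ∫⁻ t, ‖t‖ₑ ^ (2 : ℝ) ∂ρ := by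
  have hmem : ∀ j : Fin n, MemLp (fun y : Fin n → ℝ => y j) 2 (Measure.pi fun _ : Fin n => ρ) :=
    fun j => h2.comp_measurePreserving (measurePreserving_eval (fun _ : Fin n => ρ) j)
  have hmean' : ∀ j : Fin n, ∫ y, y j ∂(Measure.pi fun _ : Fin n => ρ) = 0 := fun j => by
    have h := integral_map (μ := Measure.pi fun _ : Fin n => ρ) (φ := Function.eval j)
      (f := fun t : ℝ => t) (measurable_pi_apply j).aemeasurable aestronglyMeasurable_id
    rw [(measurePreserving_eval (fun _ : Fin n => ρ) j).map_eq, hmean] at h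
    exact h.symm
  have hvar := IndepFun.variance_sum (μ := Measure.pi fun _ : Fin n => ρ)
    (X := fun (j : Fin n) y => y j) (s := s) (fun j _ => hmem j)
    (fun i _ j _ hij => (iIndepFun_pi (X := fun (_ : Fin n) (t : ℝ) => t)
      (μ := fun _ : Fin n => ρ) fun _ => aemeasurable_id).indepFun hij)
  have hzero : ∫ y, (∑ j ∈ s, fun y : Fin n → ℝ => y j) y ∂(Measure.pi fun _ : Fin n => ρ) = 0 := by
    simp_rw [Finset.sum_apply]
    rw [integral_finsetSum _ fun j _ => (hmem j).integrable (by norm_num)]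
    simp [hmean']
  have h3 := congrArg ENNReal.ofReal hvar
  rw [ENNReal.ofReal_sum_of_nonneg fun _ _ => variance_nonneg _ _,
    (memLp_finsetSum' s fun j _ => hmem j).ofReal_variance_eq,
    Finset.sum_congr rfl fun j _ => (hmem j).ofReal_variance_eq, evariance, hzero] at h3
  simp_rw [evariance, hmean', sub_zero, Finset.sum_apply] at h3
  simp_rw [ENNReal.rpow_ofNat]
  rw [h3, Finset.sum_congr rfl fun j _ =>
    (measurePreserving_eval (fun _ : Fin n => ρ) j).lintegral_comp (f := fun t : ℝ => ‖t‖ₑ ^ 2) (by fun_prop)]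
  simp

theorem lintegral_enorm_sum_rpow_le (hmean : ∫ t, t ∂ρ = 0) (h2 : MemLp (fun t : ℝ => t) 2 ρ)
    {θ : ℝ} (hθ : 0 < θ) (hθ2 : θ ≤ 2) (s : Finset (Fin n)) :
    ∫⁻ y, ‖∑ j ∈ s, y j‖ₑ ^ θ ∂(Measure.pi fun _ : Fin n => ρ) ≤
      (n * ∫⁻ t, ‖t‖ₑ ^ (2 : ℝ) ∂ρ) ^ (θ / 2) := by
  refine (lintegral_enorm_rpow_le_of_le
    (Measurable.aestronglyMeasurable (by fun_prop)) hθ hθ2).trans ?_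
  rw [lintegral_enorm_sum_sq hmean h2]
  gcongr
  simpa using s.card_le_univ

/-- The sum without `y j` is independent of `y j`, and its `θ`-th moment is controlled by the
variance since `θ ≤ 2`; the remaining part is a pure power of `y j`. -/
theorem lintegral_enorm_sum_rpow_mul_le (hmean : ∫ t, t ∂ρ = 0)
    (h2 : MemLp (fun t : ℝ => t) 2 ρ) {θ r : ℝ} (hθ : 1 ≤ θ) (hθ2 : θ ≤ 2) (hr : 0 ≤ r)
    (j : Fin n) :
    ∫⁻ y, ‖∑ j, y j‖ₑ ^ θ * ‖y j‖ₑ ^ r ∂(Measure.pi fun _ : Fin n => ρ) ≤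
      2 ^ (θ - 1) * ((n * ∫⁻ t, ‖t‖ₑ ^ (2 : ℝ) ∂ρ) ^ (θ / 2) * ∫⁻ t, ‖t‖ₑ ^ r ∂ρ +
        ∫⁻ t, ‖t‖ₑ ^ (θ + r) ∂ρ) := by
  set π := Measure.pi fun _ : Fin n => ρ
  have heval : ∀ q : ℝ, ∫⁻ y, ‖y j‖ₑ ^ q ∂π = ∫⁻ t, ‖t‖ₑ ^ q ∂ρ := fun q =>
    (measurePreserving_eval (fun _ : Fin n => ρ) j).lintegral_comp
      (f := fun t : ℝ => ‖t‖ₑ ^ q) (by fun_prop)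
  have hind : IndepFun (∑ k ∈ Finset.univ.erase j, fun y : Fin n → ℝ => y k) (fun y => y j) π :=
    (iIndepFun_pi (X := fun (_ : Fin n) (t : ℝ) => t) (μ := fun _ : Fin n => ρ)
      fun _ => aemeasurable_id).indepFun_finsetSum_of_notMem (fun k => measurable_pi_apply k)
      (Finset.notMem_erase j _)
  have hind2 := hind.comp (φ := fun t : ℝ => ‖t‖ₑ ^ θ) (ψ := fun t : ℝ => ‖t‖ₑ ^ r)
    (by fun_prop) (by fun_prop)
  have hmul : ∫⁻ y, ‖∑ k ∈ Finset.univ.erase j, y k‖ₑ ^ θ * ‖y j‖ₑ ^ r ∂π =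
      (∫⁻ y, ‖∑ k ∈ Finset.univ.erase j, y k‖ₑ ^ θ ∂π) * ∫⁻ y, ‖y j‖ₑ ^ r ∂π := by
    refine lintegral_mul_eq_lintegral_mul_lintegral_of_indepFun''
      (Measurable.aemeasurable (by fun_prop)) (Measurable.aemeasurable (by fun_prop)) ?_
    convert hind2 using 2
    · simp
    · rfl
  calc _ ≤ ∫⁻ y, 2 ^ (θ - 1) * (‖∑ k ∈ Finset.univ.erase j, y k‖ₑ ^ θ * ‖y j‖ₑ ^ r +
        ‖y j‖ₑ ^ (θ + r)) ∂π := by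
        refine lintegral_mono fun y => ?_
        rw [ENNReal.rpow_add_of_nonneg _ _ (by linarith) hr, ← add_mul, ← mul_assoc]
        gcongr
        rw [← Finset.sum_erase_add _ _ (Finset.mem_univ j)]
        exact (ENNReal.rpow_le_rpow (enorm_add_le _ _) (by linarith)).trans
          (ENNReal.rpow_add_le_mul_rpow_add_rpow _ _ hθ)
    _ = 2 ^ (θ - 1) * ((∫⁻ y, ‖∑ k ∈ Finset.univ.erase j, y k‖ₑ ^ θ ∂π) *
        (∫⁻ t, ‖t‖ₑ ^ r ∂ρ) + ∫⁻ t, ‖t‖ₑ ^ (θ + r) ∂ρ) := by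
        rw [lintegral_const_mul _ (by fun_prop), lintegral_add_left (by fun_prop), hmul, heval,
          heval]
    _ ≤ _ := by
        gcongr
        exact lintegral_enorm_sum_rpow_le hmean h2 (by linarith) hθ2 _

/-- A bound, sufficient for comparison with `n ^ (p - 1 / 2)`, for the `p`-th moment of a sum of
`n` independent centred variables. -/
theorem exists_lintegral_enorm_sum_rpow_le (hmean : ∫ t, t ∂ρ = 0)
    (h2 : MemLp (fun t : ℝ => t) 2 ρ) {p : ℝ} (hp : 1 < p)
    (hρp : MemLp (fun t : ℝ => t) (ENNReal.ofReal p) ρ) :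
    ∃ θ : ℝ, 1 < θ ∧ (p = 2 → θ = 2) ∧ ∃ C : ℝ≥0∞, C ≠ ∞ ∧ ∀ n : ℕ, 0 < n →
      ∫⁻ y, ‖∑ j, y j‖ₑ ^ p ∂(Measure.pi fun _ : Fin n => ρ) ≤ C * (n : ℝ≥0∞) ^ (p - θ / 2) := by
  have hK2 : ∫⁻ t, ‖t‖ₑ ^ (2 : ℝ) ∂ρ ≠ ∞ :=
    lintegral_enorm_rpow_ne_top two_pos (by simpa using h2)
  have hKp : ∫⁻ t, ‖t‖ₑ ^ p ∂ρ ≠ ∞ := lintegral_enorm_rpow_ne_top (by linarith) hρp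
  rcases le_or_gt p 2 with hp2 | hp2
  · refine ⟨p, hp, id, (∫⁻ t, ‖t‖ₑ ^ (2 : ℝ) ∂ρ) ^ (p / 2),
      ENNReal.rpow_ne_top_of_nonneg (by linarith) hK2, fun n hn => ?_⟩
    refine (lintegral_enorm_sum_rpow_le hmean h2 (by linarith) hp2 Finset.univ).trans_eq ?_
    rw [ENNReal.mul_rpow_of_nonneg _ _ (by linarith), mul_comm]
    congr 2
    ring
  -- For `p > 2` write `|S|^p = |S|^θ |S|^r` and expand only the second factor, `|S|^r ≤ n^(r-1) ∑
  -- |y_j|^r`, which needs `r ≥ 1`. Cancellation in the first factor needs `θ ≤ 2`. No moment beyond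
  -- the `p`-th enters.
  · obtain ⟨θ, r, hθ, hθ2, hr, hθr⟩ : ∃ θ r : ℝ, 1 < θ ∧ θ ≤ 2 ∧ 1 ≤ r ∧ θ + r = p := by
      refine ⟨min (p - 1) 2, p - min (p - 1) 2, lt_min (by linarith) (by norm_num),
        min_le_right _ _, ?_, by ring⟩
      linarith [min_le_left (p - 1) 2]
    have hKr : ∫⁻ t, ‖t‖ₑ ^ r ∂ρ ≠ ∞ := ne_top_of_le_ne_top
      (ENNReal.rpow_ne_top_of_nonneg (by positivity) hKp)
      (lintegral_enorm_rpow_le_of_le hρp.1 (by linarith) (show r ≤ p by linarith))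
    refine ⟨θ, hθ, fun h => absurd h hp2.ne', 2 ^ (θ - 1) *
      ((∫⁻ t, ‖t‖ₑ ^ (2 : ℝ) ∂ρ) ^ (θ / 2) * (∫⁻ t, ‖t‖ₑ ^ r ∂ρ) + ∫⁻ t, ‖t‖ₑ ^ p ∂ρ), ?_,
      fun n hn => ?_⟩
    · exact ENNReal.mul_ne_top (ENNReal.rpow_ne_top_of_nonneg (by linarith) (by simp))
        (ENNReal.add_ne_top.2 ⟨ENNReal.mul_ne_top
          (ENNReal.rpow_ne_top_of_nonneg (by linarith) hK2) hKr, hKp⟩)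
    set π := Measure.pi fun _ : Fin n => ρ
    have hn0 : (n : ℝ≥0∞) ≠ 0 := by exact_mod_cast hn.ne'
    have hn1 : (1 : ℝ≥0∞) ≤ (n : ℝ≥0∞) ^ (θ / 2) :=
      ENNReal.one_le_rpow (by exact_mod_cast hn) (by linarith)
    calc ∫⁻ y, ‖∑ j, y j‖ₑ ^ p ∂π
        ≤ ∫⁻ y, (n : ℝ≥0∞) ^ (r - 1) * ∑ j, ‖∑ j, y j‖ₑ ^ θ * ‖y j‖ₑ ^ r ∂π := by
          refine lintegral_mono fun y => ?_
          simp only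
          rw [← hθr, ENNReal.rpow_add_of_nonneg _ _ (by linarith) (by linarith),
            ← Finset.mul_sum, mul_left_comm]
          gcongr
          refine (ENNReal.rpow_le_rpow (enorm_sum_le _ _) (by linarith)).trans ?_
          simpa using ENNReal.rpow_sum_le_const_mul_sum_rpow Finset.univ (fun j => ‖y j‖ₑ) hr
      _ = (n : ℝ≥0∞) ^ (r - 1) * ∑ j, ∫⁻ y, ‖∑ j, y j‖ₑ ^ θ * ‖y j‖ₑ ^ r ∂π := by
          rw [lintegral_const_mul _ (by fun_prop), lintegral_finsetSum _ (by fun_prop)]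
      _ ≤ (n : ℝ≥0∞) ^ (r - 1) * ∑ _j : Fin n, 2 ^ (θ - 1) *
          (((n : ℝ≥0∞) * ∫⁻ t, ‖t‖ₑ ^ (2 : ℝ) ∂ρ) ^ (θ / 2) * (∫⁻ t, ‖t‖ₑ ^ r ∂ρ) +
            ∫⁻ t, ‖t‖ₑ ^ (θ + r) ∂ρ) := by
          gcongr with j
          exact lintegral_enorm_sum_rpow_mul_le hmean h2 hθ.le hθ2 (by linarith) j
      _ ≤ (n : ℝ≥0∞) ^ (r - 1) * ∑ _j : Fin n, 2 ^ (θ - 1) *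
          ((n : ℝ≥0∞) ^ (θ / 2) * ((∫⁻ t, ‖t‖ₑ ^ (2 : ℝ) ∂ρ) ^ (θ / 2) * (∫⁻ t, ‖t‖ₑ ^ r ∂ρ) +
            ∫⁻ t, ‖t‖ₑ ^ p ∂ρ)) := by
          rw [ENNReal.mul_rpow_of_nonneg _ _ (by linarith), mul_add ((n : ℝ≥0∞) ^ (θ / 2)), hθr,
            mul_assoc]
          gcongr
          exact le_mul_of_one_le_left zero_le hn1
      _ = _ := by
          rw [Finset.sum_const, Finset.card_univ, Fintype.card_fin, nsmul_eq_mul]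
          have : (n : ℝ≥0∞) ^ (p - θ / 2) = (n : ℝ≥0∞) ^ (r - 1) * n * (n : ℝ≥0∞) ^ (θ / 2) := by
            rw [show p - θ / 2 = (r - 1) + 1 + θ / 2 by linarith,
              ENNReal.rpow_add _ _ hn0 (by simp), ENNReal.rpow_add _ _ hn0 (by simp),
              ENNReal.rpow_one]
          rw [this]
          ring

/-! ### Deterministic comparison of the costs for `1` and `p` -/

theorem sum_rpow_le_rpow_sum {ι : Type*} (s : Finset ι) (f : ι → ℝ) (hf : ∀ i, 0 ≤ f i) {p : ℝ}
    (hp : 1 ≤ p) : ∑ i ∈ s, f i ^ p ≤ (∑ i ∈ s, f i) ^ p := by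
  classical
  induction s using Finset.induction_on with
  | empty => simp [Real.zero_rpow (show p ≠ 0 by linarith)]
  | insert i s hi ih =>
    rw [Finset.sum_insert hi, Finset.sum_insert hi]
    exact (add_le_add_right ih _).trans
      (Real.add_rpow_le_rpow_add (hf i) (Finset.sum_nonneg fun i _ => hf i) hp)

theorem imageSum_le_rpow {m n : ℕ} {p : ℝ} (hp : 1 ≤ p) (a : Fin m → Fin n → ℝ) (x : Fin n → ℝ) :
    imageSum p a x ≤ imageSum 1 a x ^ p := by
  rw [imageSum_one]
  exact sum_rpow_le_rpow_sum _ _ (fun _ => abs_nonneg _) hp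

theorem imageSum_pos_of_one {m n : ℕ} {p : ℝ} {a : Fin m → Fin n → ℝ} {x : Fin n → ℝ}
    (h : 0 < imageSum 1 a x) : 0 < imageSum p a x := by
  rw [imageSum_one] at h
  obtain ⟨i, -, hi⟩ := Finset.exists_ne_zero_of_sum_ne_zero h.ne'
  exact Finset.sum_pos' (fun j _ => by positivity)
    ⟨i, Finset.mem_univ _, Real.rpow_pos_of_pos (lt_of_le_of_ne (abs_nonneg _) hi.symm) p⟩

/-- Power mean inequality over all `m n` entries. Through it both the upper and the lower bound
reduce to `W_1`, for which two moments of `ν` suffice. -/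
theorem entrySum_one_rpow_le {m n : ℕ} {p : ℝ} (hp : 1 ≤ p) (a : Fin m → Fin n → ℝ)
    (x : Fin n → ℝ) :
    entrySum 1 a x ^ p ≤ ((m : ℝ) * n) ^ (p - 1) * entrySum p a x := by
  have h := Real.rpow_sum_le_const_mul_sum_rpow (Finset.univ : Finset (Fin m × Fin n))
    (fun q => x q.2 * a q.1 q.2) hp
  rw [Fintype.sum_prod_type, Fintype.sum_prod_type, Finset.card_univ, Fintype.card_prod,
    Fintype.card_fin, Fintype.card_fin, Nat.cast_mul] at h
  rw [entrySum_one]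
  exact h

/-- Where the sampler for `p = 1` is very slow, the sampler for `p` is slower still. -/
theorem sqrt_rpow_mul_costRatio_one_le {m n : ℕ} (hm : 0 < m) (hn : 0 < n) {p : ℝ} (hp : 1 ≤ p)
    (a : Fin m → Fin n → ℝ) (x : Fin n → ℝ) (h : m * √n ≤ costRatio 1 a x) :
    √n ^ (p - 1) * costRatio 1 a x ≤ costRatio p a x := by
  have hm0 : (0 : ℝ) < m := by exact_mod_cast hm
  have hn0 : (0 : ℝ) < n := by exact_mod_cast hn
  have hc : costRatio 1 a x = entrySum 1 a x / imageSum 1 a x := by simp [costRatio]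
  have hpos : 0 < costRatio 1 a x := lt_of_lt_of_le (by positivity) h
  have hZ : 0 < imageSum 1 a x := by
    refine lt_of_le_of_ne (imageSum_nonneg _ _ _) fun h0 => ?_
    rw [hc, ← h0, div_zero] at hpos
    exact hpos.false
  have hV : 0 < imageSum p a x := imageSum_pos_of_one hZ
  set R := costRatio 1 a x with hR
  have hW : entrySum 1 a x = R * imageSum 1 a x := by rw [hc]; field_simp
  -- The chain shows `R_1^p ≤ m^(p-1) R_p`, and the assumption on `R_1` says `√n ≤ R_1 / m`.
  calc √n ^ (p - 1) * R ≤ (R / m) ^ (p - 1) * R := by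
        gcongr
        rw [le_div_iff₀ hm0]
        linarith
    _ = (n : ℝ) ^ (p - 1) * (entrySum 1 a x ^ p / ((m : ℝ) * n) ^ (p - 1)) / imageSum 1 a x ^ p := by
        rw [hW, Real.mul_rpow hpos.le hZ.le, Real.mul_rpow hm0.le hn0.le,
          Real.div_rpow hpos.le hm0.le]
        have h1 : R ^ p = R ^ (p - 1) * R := by
          rw [← Real.rpow_add_one hpos.ne', sub_add_cancel]
        have h2 := (Real.rpow_pos_of_pos hm0 (p - 1)).ne'
        have h3 := (Real.rpow_pos_of_pos hn0 (p - 1)).ne'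
        have h4 := (Real.rpow_pos_of_pos hZ p).ne'
        rw [h1]
        field_simp
    _ ≤ (n : ℝ) ^ (p - 1) * entrySum p a x / imageSum 1 a x ^ p := by
        gcongr
        rw [div_le_iff₀ (by positivity), mul_comm]
        exact entrySum_one_rpow_le hp a x
    _ ≤ _ := by
        rw [costRatio]
        have := entrySum_nonneg p a x
        gcongr
        exact imageSum_le_rpow hp a x

/-! ### Upper bound for the mean cost at `p = 1` -/

/-- The law of a vector of `n` independent entries. -/
noncomputable abbrev vecLaw (ν : Measure ℝ) (n : ℕ) : Measure (Fin n → ℝ) :=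
  Measure.pi fun _ => ν

/-- The joint law of the vector and of the rows of the matrix. -/
noncomputable abbrev instanceLaw (ν : Measure ℝ) (m n : ℕ) :
    Measure ((Fin n → ℝ) × (Fin m → Fin n → ℝ)) :=
  (vecLaw ν n).prod (Measure.pi fun _ => vecLaw ν n)

@[fun_prop]
theorem measurable_entrySum {m n : ℕ} (p : ℝ) :
    Measurable fun z : (Fin n → ℝ) × (Fin m → Fin n → ℝ) => entrySum p z.2 z.1 := by
  unfold entrySum
  fun_prop

@[fun_prop]
theorem measurable_imageSum {m n : ℕ} (p : ℝ) :
    Measurable fun z : (Fin n → ℝ) × (Fin m → Fin n → ℝ) => imageSum p z.2 z.1 := by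
  unfold imageSum
  fun_prop

@[fun_prop]
theorem measurable_costRatio {m n : ℕ} (p : ℝ) :
    Measurable fun z : (Fin n → ℝ) × (Fin m → Fin n → ℝ) => costRatio p z.2 z.1 := by
  unfold costRatio
  fun_prop

@[fun_prop]
theorem measurable_euclid {n : ℕ} : Measurable fun x : Fin n → ℝ => euclid x := by
  unfold euclid
  fun_prop

/-- The instances with `x ≠ 0` and `‖a x‖₁ ≤ η m ‖x‖₂`. -/
def smallImage (m n : ℕ) (η : ℝ) : Set ((Fin n → ℝ) × (Fin m → Fin n → ℝ)) :=
  {z | z.1 ≠ 0 ∧ imageSum 1 z.2 z.1 ≤ η * m * euclid z.1}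

theorem measurableSet_smallImage (m n : ℕ) (η : ℝ) : MeasurableSet (smallImage m n η) := by
  have h : MeasurableSet {z : (Fin n → ℝ) × (Fin m → Fin n → ℝ) |
      imageSum 1 z.2 z.1 ≤ η * m * euclid z.1} := measurableSet_le (by fun_prop) (by fun_prop)
  exact (measurable_fst (measurableSet_singleton 0)).compl.inter h

section

variable {ν : Measure ℝ} [IsProbabilityMeasure ν]

/-- Fubini in `x`: the bound for fixed `x ≠ 0` is uniform, and the slice at `x = 0` is empty by
definition. -/
theorem exists_instanceLaw_smallImage_le
    (hmean : ∫ t, t ∂ν = 0) (hvar : MemLp (fun t : ℝ => t) 2 ν) (hpos : 0 < ∫ t, t ^ 2 ∂ν) :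
    ∃ η > 0, ∃ C > 0, ∀ m n : ℕ, 0 < m →
      instanceLaw ν m n (smallImage m n η) ≤ ENNReal.ofReal (C / m) := by
  obtain ⟨η, hη, C, hC, h⟩ := exists_measure_imageSum_le hmean hvar hpos
  refine ⟨η, hη, C, hC, fun m n hm => ?_⟩
  rw [Measure.prod_apply (measurableSet_smallImage m n η)]
  calc _ ≤ ∫⁻ _x, ENNReal.ofReal (C / m) ∂(vecLaw ν n) := by
        refine lintegral_mono fun x => ?_
        by_cases hx : x = 0
        · have : Prod.mk x ⁻¹' smallImage m n η = ∅ := by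
            ext a; simp [smallImage, hx]
          rw [this]; simp
        · refine le_trans (measure_mono ?_) (h m n x hm hx)
          exact fun a ha => ha.2
    _ = _ := by simp

theorem lintegral_sum_rows {m n : ℕ} {f : (Fin n → ℝ) × (Fin n → ℝ) → ℝ≥0∞} (hf : Measurable f) :
    ∫⁻ z, ∑ i, f (z.1, z.2 i) ∂(instanceLaw ν m n) =
      m * ∫⁻ z, f z ∂((vecLaw ν n).prod (vecLaw ν n)) := by
  rw [lintegral_finsetSum _ fun i _ => by fun_prop]
  have : ∀ i : Fin m, ∫⁻ z, f (z.1, z.2 i) ∂(instanceLaw ν m n) =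
      ∫⁻ z, f z ∂((vecLaw ν n).prod (vecLaw ν n)) := fun i =>
    ((MeasurePreserving.id (vecLaw ν n)).prod
      (measurePreserving_eval (fun _ : Fin m => vecLaw ν n) i)).lintegral_comp hf
  simp [this]

theorem measurePreserving_mul (n : ℕ) :
    MeasurePreserving (fun (z : (Fin n → ℝ) × (Fin n → ℝ)) (j : Fin n) => z.1 j * z.2 j)
      ((vecLaw ν n).prod (vecLaw ν n))
      (Measure.pi fun _ => (ν.prod ν).map fun q => q.1 * q.2) := by
  have h1 := (measurePreserving_arrowProdEquivProdArrow ℝ ℝ (Fin n) (fun _ => ν)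
    (fun _ => ν)).symm
  have h2 : MeasurePreserving (fun (y : Fin n → ℝ × ℝ) j => (y j).1 * (y j).2)
      (Measure.pi fun _ => ν.prod ν) (Measure.pi fun _ => (ν.prod ν).map fun q => q.1 * q.2) := by
    refine ⟨by fun_prop, ?_⟩
    have : ∀ _ : Fin n, IsProbabilityMeasure ((ν.prod ν).map fun q : ℝ × ℝ => q.1 * q.2) :=
      fun _ => Measure.isProbabilityMeasure_map (by fun_prop)
    exact Measure.pi_map_pi (μ := fun _ : Fin n => ν.prod ν)
      (f := fun _ (q : ℝ × ℝ) => q.1 * q.2) fun _ => by fun_prop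
  exact h2.comp h1

theorem lintegral_entry {n : ℕ} {f : ℝ → ℝ≥0∞} (hf : Measurable f) (j : Fin n) :
    ∫⁻ z, f (z.1 j * z.2 j) ∂((vecLaw ν n).prod (vecLaw ν n)) =
      ∫⁻ q, f (q.1 * q.2) ∂(ν.prod ν) :=
  ((measurePreserving_eval (fun _ : Fin n => ν) j).prod
    (measurePreserving_eval (fun _ : Fin n => ν) j)).lintegral_comp
      (f := fun q : ℝ × ℝ => f (q.1 * q.2)) (by fun_prop)

/-- Integrating over the matrix first turns `W_1` into `m ‖x‖₁ E|t|`, and Cauchy–Schwarz gives `‖x‖₁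
≤ √n ‖x‖₂`, so the integral over `x` is of a bounded function. -/
theorem lintegral_entrySum_one_div_euclid_le {m n : ℕ} {η : ℝ} (hη : 0 < η) (hm : 0 < m) :
    ∫⁻ z, ENNReal.ofReal (entrySum 1 z.2 z.1 / (η * m * euclid z.1)) ∂(instanceLaw ν m n) ≤
      ENNReal.ofReal (√n / η) * ∫⁻ t, ENNReal.ofReal |t| ∂ν := by
  have hm0 : (0 : ℝ) < m := by exact_mod_cast hm
  set κ := ∫⁻ t, ENNReal.ofReal |t| ∂ν
  set g : (Fin n → ℝ) × (Fin n → ℝ) → ℝ≥0∞ := fun z =>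
    ∑ j, ENNReal.ofReal (|z.1 j| / (η * m * euclid z.1)) * ENNReal.ofReal |z.2 j| with hg
  have hgm : Measurable g := by rw [hg]; fun_prop
  have h1 : ∀ z : (Fin n → ℝ) × (Fin m → Fin n → ℝ),
      ENNReal.ofReal (entrySum 1 z.2 z.1 / (η * m * euclid z.1)) = ∑ i, g (z.1, z.2 i) := by
    intro z
    have he := euclid_nonneg z.1
    rw [entrySum_one, Finset.sum_div, ENNReal.ofReal_sum_of_nonneg fun i _ => by positivity]
    refine Finset.sum_congr rfl fun i _ => ?_
    rw [Finset.sum_div, ENNReal.ofReal_sum_of_nonneg fun i _ => by positivity]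
    refine Finset.sum_congr rfl fun j _ => ?_
    rw [← ENNReal.ofReal_mul (by positivity), abs_mul]
    congr 1
    ring
  simp_rw [h1]
  rw [lintegral_sum_rows hgm, lintegral_prod _ hgm.aemeasurable]
  have h2 : ∀ x : Fin n → ℝ, ∫⁻ b, g (x, b) ∂(vecLaw ν n) ≤ ENNReal.ofReal (√n / (η * m)) * κ := by
    intro x
    have he := euclid_nonneg x
    rw [hg, lintegral_finsetSum _ fun j _ => by fun_prop]
    have h3 : ∀ j : Fin n, ∫⁻ b, ENNReal.ofReal (|x j| / (η * m * euclid x)) *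
        ENNReal.ofReal |b j| ∂(vecLaw ν n) = ENNReal.ofReal (|x j| / (η * m * euclid x)) * κ := by
      intro j
      rw [lintegral_const_mul _ (by fun_prop)]
      congr 1
      exact (measurePreserving_eval (fun _ : Fin n => ν) j).lintegral_comp
        (f := fun t : ℝ => ENNReal.ofReal |t|) (by fun_prop)
    rw [Finset.sum_congr rfl fun j _ => h3 j, ← Finset.sum_mul,
      ← ENNReal.ofReal_sum_of_nonneg fun i _ => by positivity, ← Finset.sum_div]
    gcongr ENNReal.ofReal ?_ * _
    have h4 : ∑ j, |x j| ≤ √n * euclid x := by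
      rw [euclid, ← Real.sqrt_mul (by positivity)]
      refine Real.le_sqrt_of_sq_le ?_
      simpa using sq_sum_le_card_mul_sum_sq (s := Finset.univ) (f := fun j => |x j|)
    rcases he.eq_or_lt with h0 | h0
    · rw [← h0, mul_zero, div_zero]; positivity
    · rw [div_le_div_iff₀ (by positivity) (by positivity)]
      nlinarith [mul_pos hη hm0]
  calc _ ≤ (m : ℝ≥0∞) * ∫⁻ _x, ENNReal.ofReal (√n / (η * m)) * κ ∂(vecLaw ν n) := by
        gcongr with x; exact h2 x
    _ = _ := by
        rw [lintegral_const, measure_univ, mul_one, ← mul_assoc, ← ENNReal.ofReal_natCast,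
          ← ENNReal.ofReal_mul (by positivity)]
        congr 2
        field_simp

/-- The mean cost for `p = 1` is at most `O(√n)`, up to a small multiple of the mean cost for `p`. -/
theorem exists_lintegral_costRatio_one_le
    (hmean : ∫ t, t ∂ν = 0) (hvar : MemLp (fun t : ℝ => t) 2 ν) (hpos : 0 < ∫ t, t ^ 2 ∂ν) :
    ∃ C : ℝ, 0 < C ∧ ∀ m n : ℕ, 0 < m → 0 < n → ∀ p : ℝ, 1 ≤ p →
      ∫⁻ z, ENNReal.ofReal (costRatio 1 z.2 z.1) ∂(instanceLaw ν m n) ≤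
        ENNReal.ofReal (C * √n) + ENNReal.ofReal (√n ^ (1 - p)) *
          ∫⁻ z, ENNReal.ofReal (costRatio p z.2 z.1) ∂(instanceLaw ν m n) := by
  obtain ⟨η, hη, C, hC, hsmall⟩ := exists_instanceLaw_smallImage_le hmean hvar hpos
  have hint : Integrable (fun t : ℝ => t) ν := hvar.integrable (by norm_num)
  have hκ : ∫⁻ t, ENNReal.ofReal |t| ∂ν = ENNReal.ofReal (∫ t, |t| ∂ν) :=
    (ofReal_integral_eq_lintegral_ofReal hint.abs (Eventually.of_forall fun t => abs_nonneg t)).symm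
  have hκ0 : 0 ≤ ∫ t, |t| ∂ν := integral_nonneg fun t => abs_nonneg t
  refine ⟨C + (∫ t, |t| ∂ν) / η, by positivity, fun m n hm hn p hp => ?_⟩
  have hm0 : (0 : ℝ) < m := by exact_mod_cast hm
  have hn0 : (0 : ℝ) < n := by exact_mod_cast hn
  -- The three terms cover, in order: cost below `m √n` with small image, image not small, and cost
  -- at least `m √n`.
  have hpt : ∀ z : (Fin n → ℝ) × (Fin m → Fin n → ℝ), ENNReal.ofReal (costRatio 1 z.2 z.1) ≤
      (smallImage m n η).indicator (fun _ => ENNReal.ofReal (m * √n)) z +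
        ENNReal.ofReal (entrySum 1 z.2 z.1 / (η * m * euclid z.1)) +
        ENNReal.ofReal (√n ^ (1 - p)) * ENNReal.ofReal (costRatio p z.2 z.1) := by
    rintro ⟨x, a⟩
    simp only
    by_cases hx : x = 0
    · have : costRatio 1 a x = 0 := by simp [costRatio, imageSum, entrySum, hx]
      simp [this]
    by_cases hbig : m * √n ≤ costRatio 1 a x
    · refine le_add_left ?_
      rw [← ENNReal.ofReal_mul (by positivity)]
      refine ENNReal.ofReal_le_ofReal ?_
      have h := sqrt_rpow_mul_costRatio_one_le hm hn hp a x hbig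
      have hs : 0 < √(n : ℝ) := Real.sqrt_pos.2 hn0
      calc costRatio 1 a x = √n ^ (1 - p) * (√n ^ (p - 1) * costRatio 1 a x) := by
            rw [← mul_assoc, ← Real.rpow_add hs]; simp
        _ ≤ _ := by gcongr
    refine le_add_right ?_
    by_cases hz : (x, a) ∈ smallImage m n η
    · refine le_add_right ?_
      rw [Set.indicator_of_mem hz]
      exact ENNReal.ofReal_le_ofReal (not_le.1 hbig).le
    · refine le_add_left (ENNReal.ofReal_le_ofReal ?_)
      have h1 : η * m * euclid x < imageSum 1 a x := by
        by_contra hle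
        exact hz ⟨hx, not_lt.1 hle⟩
      have := euclid_pos hx
      have hW := entrySum_nonneg 1 a x
      rw [costRatio, sub_self, Real.rpow_zero, one_mul]
      gcongr
  refine (lintegral_mono hpt).trans ?_
  rw [lintegral_add_right _ (by fun_prop), lintegral_add_right _ (by fun_prop),
    lintegral_indicator_const (measurableSet_smallImage m n η), lintegral_const_mul _ (by fun_prop)]
  gcongr
  calc _ ≤ ENNReal.ofReal (m * √n) * ENNReal.ofReal (C / m) +
        ENNReal.ofReal (√n / η) * ENNReal.ofReal (∫ t, |t| ∂ν) := by
        gcongr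
        · exact hsmall m n hm
        · rw [← hκ]; exact lintegral_entrySum_one_div_euclid_le hη hm
    _ = _ := by
        rw [← ENNReal.ofReal_mul (by positivity), ← ENNReal.ofReal_mul (by positivity),
          ← ENNReal.ofReal_add (by positivity) (by positivity)]
        congr 1
        field_simp

end

/-! ### Lower bound for the mean cost at `p > 1` -/

theorem memLp_mul_law {ν : Measure ℝ} {q : ℝ≥0∞} (hq0 : q ≠ 0) (hq : q ≠ ∞)
    (h : MemLp (fun t : ℝ => t) q ν) :
    MemLp (fun t : ℝ => t) q ((ν.prod ν).map fun z => z.1 * z.2) := by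
  refine (memLp_map_measure_iff (f := fun z : ℝ × ℝ => z.1 * z.2) aestronglyMeasurable_id
    (by fun_prop)).2 ?_
  have hi := (integrable_norm_rpow_iff aestronglyMeasurable_id hq0 hq).2 h
  refine (integrable_norm_rpow_iff (Measurable.aestronglyMeasurable (by fun_prop)) hq0 hq).1 ?_
  refine (hi.mul_prod hi).congr (Eventually.of_forall fun z => ?_)
  simp [Real.mul_rpow (abs_nonneg z.1) (abs_nonneg z.2)]

section

variable {ν : Measure ℝ} [IsProbabilityMeasure ν]

theorem integral_mul_law (hmean : ∫ t, t ∂ν = 0) :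
    ∫ t, t ∂((ν.prod ν).map fun z => z.1 * z.2) = 0 := by
  have h := integral_map (μ := ν.prod ν) (φ := fun z : ℝ × ℝ => z.1 * z.2)
    (f := fun t : ℝ => t) (by fun_prop) aestronglyMeasurable_id
  rw [h, integral_prod_mul (μ := ν) (ν := ν) (fun t : ℝ => t) (fun t : ℝ => t), hmean, zero_mul]

/-- The mean of `‖a x‖_p ^ p` is `O(m n ^ (p - θ / 2))` for some `θ > 1`. -/
theorem exists_lintegral_imageSum_le (hmean : ∫ t, t ∂ν = 0)
    (h2 : MemLp (fun t : ℝ => t) 2 ν) {p : ℝ} (hp : 1 < p)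
    (hνp : MemLp (fun t : ℝ => t) (ENNReal.ofReal p) ν) :
    ∃ θ : ℝ, 1 < θ ∧ (p = 2 → θ = 2) ∧ ∃ C : ℝ, 0 < C ∧ ∀ m n : ℕ, 0 < n →
      ∫⁻ z, ENNReal.ofReal (imageSum p z.2 z.1) ∂(instanceLaw ν m n) ≤
        ENNReal.ofReal (C * (m * (n : ℝ) ^ (p - θ / 2))) := by
  have : IsProbabilityMeasure ((ν.prod ν).map fun q : ℝ × ℝ => q.1 * q.2) :=
    Measure.isProbabilityMeasure_map (by fun_prop)
  obtain ⟨θ, hθ, hθ2, C, hC, h⟩ := exists_lintegral_enorm_sum_rpow_le (integral_mul_law hmean)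
    (memLp_mul_law (by simp) (by simp) h2) hp
    (memLp_mul_law (by simpa using by linarith) ENNReal.ofReal_ne_top hνp)
  refine ⟨θ, hθ, hθ2, C.toReal + 1, by positivity, fun m n hn => ?_⟩
  have hn0 : (0 : ℝ) < n := by exact_mod_cast hn
  set f : (Fin n → ℝ) × (Fin n → ℝ) → ℝ≥0∞ := fun z => ‖∑ j, z.1 j * z.2 j‖ₑ ^ p with hf
  have hfm : Measurable f := by rw [hf]; fun_prop
  have h1 : ∀ z : (Fin n → ℝ) × (Fin m → Fin n → ℝ),
      ENNReal.ofReal (imageSum p z.2 z.1) = ∑ i, f (z.1, z.2 i) := by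
    intro z
    rw [imageSum, ENNReal.ofReal_sum_of_nonneg fun i _ => by positivity]
    refine Finset.sum_congr rfl fun i _ => ?_
    simp only [hf]
    rw [← ENNReal.ofReal_rpow_of_nonneg (abs_nonneg _) (by linarith), Real.enorm_eq_ofReal_abs]
  simp_rw [h1]
  rw [lintegral_sum_rows hfm]
  have h3 := (measurePreserving_mul (ν := ν) n).lintegral_comp
    (f := fun y : Fin n → ℝ => ‖∑ j, y j‖ₑ ^ p) (by fun_prop)
  rw [hf, h3]
  calc _ ≤ (m : ℝ≥0∞) * (C * (n : ℝ≥0∞) ^ (p - θ / 2)) := by gcongr; exact h n hn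
    _ ≤ (m : ℝ≥0∞) * (ENNReal.ofReal (C.toReal + 1) * (n : ℝ≥0∞) ^ (p - θ / 2)) := by
        gcongr
        rw [← ENNReal.ofReal_toReal hC]
        exact ENNReal.ofReal_le_ofReal (by rw [ENNReal.toReal_ofReal (by positivity)]; linarith)
    _ = _ := by
        rw [← ENNReal.ofReal_natCast m, ← ENNReal.ofReal_natCast n,
          ENNReal.ofReal_rpow_of_pos hn0, ← ENNReal.ofReal_mul (by positivity),
          ← ENNReal.ofReal_mul (by positivity)]
        congr 1
        ring

theorem lintegral_entrySum {r : ℝ} (hr : Integrable (fun t : ℝ => |t| ^ r) ν) (m n : ℕ) :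
    ∫⁻ z, ENNReal.ofReal (entrySum r z.2 z.1) ∂(instanceLaw ν m n) =
      ENNReal.ofReal (m * (n * (∫ t, |t| ^ r ∂ν) ^ 2)) := by
  set f : (Fin n → ℝ) × (Fin n → ℝ) → ℝ≥0∞ := fun z =>
    ∑ j, ENNReal.ofReal (|z.1 j * z.2 j| ^ r) with hf
  have hfm : Measurable f := by rw [hf]; fun_prop
  have h1 : ∀ z : (Fin n → ℝ) × (Fin m → Fin n → ℝ),
      ENNReal.ofReal (entrySum r z.2 z.1) = ∑ i, f (z.1, z.2 i) := by
    intro z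
    rw [entrySum, ENNReal.ofReal_sum_of_nonneg fun i _ => by positivity]
    exact Finset.sum_congr rfl fun i _ => ENNReal.ofReal_sum_of_nonneg fun j _ => by positivity
  have hκ : ∫⁻ t, ENNReal.ofReal (|t| ^ r) ∂ν = ENNReal.ofReal (∫ t, |t| ^ r ∂ν) :=
    (ofReal_integral_eq_lintegral_ofReal hr (Eventually.of_forall fun t => by positivity)).symm
  have hκ0 : 0 ≤ ∫ t, |t| ^ r ∂ν := integral_nonneg fun t => by positivity
  have h2 : ∫⁻ q, ENNReal.ofReal (|q.1 * q.2| ^ r) ∂(ν.prod ν) =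
      ENNReal.ofReal ((∫ t, |t| ^ r ∂ν) ^ 2) := by
    have : ∀ q : ℝ × ℝ, ENNReal.ofReal (|q.1 * q.2| ^ r) =
        ENNReal.ofReal (|q.1| ^ r) * ENNReal.ofReal (|q.2| ^ r) := fun q => by
      rw [← ENNReal.ofReal_mul (by positivity), abs_mul,
        Real.mul_rpow (abs_nonneg _) (abs_nonneg _)]
    simp_rw [this]
    rw [lintegral_prod_mul (f := fun t : ℝ => ENNReal.ofReal (|t| ^ r))
      (g := fun t : ℝ => ENNReal.ofReal (|t| ^ r)) (by fun_prop) (by fun_prop), hκ, sq,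
      ENNReal.ofReal_mul hκ0]
  simp_rw [h1]
  rw [lintegral_sum_rows hfm, hf, lintegral_finsetSum _ fun j _ => by fun_prop,
    Finset.sum_congr rfl fun j _ =>
      lintegral_entry (f := fun t : ℝ => ENNReal.ofReal (|t| ^ r)) (by fun_prop) j, h2,
    Finset.sum_const, Finset.card_univ, Fintype.card_fin, nsmul_eq_mul,
    ENNReal.ofReal_mul (by positivity), ENNReal.ofReal_mul (by positivity),
    ENNReal.ofReal_natCast, ENNReal.ofReal_natCast]

theorem lintegral_entrySum_one (hν : MemLp (fun t : ℝ => t) 2 ν) (m n : ℕ) :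
    ∫⁻ z, ENNReal.ofReal (entrySum 1 z.2 z.1) ∂(instanceLaw ν m n) =
      ENNReal.ofReal (m * (n * (∫ t, |t| ∂ν) ^ 2)) := by
  have hint : Integrable (fun t : ℝ => |t| ^ (1 : ℝ)) ν := by
    simp_rw [Real.rpow_one]
    exact (hν.integrable (by norm_num)).abs
  rw [lintegral_entrySum hint]
  simp_rw [Real.rpow_one]

/-- Since `W_1² ≤ m n W_2`, the mean of `W_2` suffices and the dependence between entries sharing an
`x_j` plays no role. -/
theorem lintegral_entrySum_one_sq_le (hν : MemLp (fun t : ℝ => t) 2 ν) (m n : ℕ) :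
    ∫⁻ z, ENNReal.ofReal (entrySum 1 z.2 z.1 ^ 2) ∂(instanceLaw ν m n) ≤
      ENNReal.ofReal ((m * n) ^ 2 * (∫ t, t ^ 2 ∂ν) ^ 2) := by
  have hint : Integrable (fun t : ℝ => |t| ^ (2 : ℝ)) ν := by
    simp_rw [Real.rpow_two, sq_abs]
    exact hν.integrable_sq
  calc _ ≤ ∫⁻ z, ENNReal.ofReal (m * n) * ENNReal.ofReal (entrySum 2 z.2 z.1)
        ∂(instanceLaw ν m n) := by
        refine lintegral_mono fun z => ?_
        rw [← ENNReal.ofReal_mul (by positivity)]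
        refine ENNReal.ofReal_le_ofReal ?_
        have h := entrySum_one_rpow_le (p := 2) (by norm_num) z.2 z.1
        rwa [show (2 : ℝ) - 1 = 1 by norm_num, Real.rpow_one, Real.rpow_two] at h
    _ = _ := by
        rw [lintegral_const_mul _ (by fun_prop), lintegral_entrySum hint,
          ← ENNReal.ofReal_mul (by positivity)]
        simp_rw [Real.rpow_two, sq_abs]
        congr 1
        ring

theorem integral_abs_pos (hvar : MemLp (fun t : ℝ => t) 2 ν) (hpos : 0 < ∫ t, t ^ 2 ∂ν) :
    0 < ∫ t, |t| ∂ν := by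
  refine lt_of_le_of_ne (integral_nonneg fun t => abs_nonneg t) fun h => hpos.ne' ?_
  have h0 := (integral_eq_zero_iff_of_nonneg (fun t => abs_nonneg t)
    (hvar.integrable (by norm_num)).abs).1 h.symm
  refine integral_eq_zero_of_ae (h0.mono fun t ht => ?_)
  have : t = 0 := abs_eq_zero.1 ht
  simp [this]

/-- The numerator hypothesis is on `W_1` and not on `W_p`: a second moment argument for `W_p` would
require `2p` moments of `ν`. -/
theorem le_costRatio {m n : ℕ} (hm : 0 < m) (hn : 0 < n) {p θ w K : ℝ} (hp : 1 ≤ p) (hw : 0 < w)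
    (hK : 0 < K) {a : Fin m → Fin n → ℝ} {x : Fin n → ℝ} (h1 : w * (m * n) ≤ entrySum 1 a x)
    (h2 : 0 < imageSum p a x) (h3 : imageSum p a x ≤ K * (m * (n : ℝ) ^ (p - θ / 2))) :
    w ^ p / K * (n : ℝ) ^ (θ / 2) ≤ costRatio p a x := by
  have hm0 : (0 : ℝ) < m := by exact_mod_cast hm
  have hn0 : (0 : ℝ) < n := by exact_mod_cast hn
  have h4 := entrySum_one_rpow_le (p := p) (by linarith) a x
  have h5 : (w * (m * n)) ^ p ≤ entrySum 1 a x ^ p := by gcongr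
  have h6 : w ^ p * (m * n) ≤ entrySum p a x := by
    refine le_of_mul_le_mul_left (le_trans (le_of_eq ?_) (h5.trans h4))
      (Real.rpow_pos_of_pos (mul_pos hm0 hn0) (p - 1))
    have e : ((m : ℝ) * n) ^ p = (m * n) ^ (p - 1) * (m * n) := by
      rw [← Real.rpow_add_one (by positivity), sub_add_cancel]
    rw [Real.mul_rpow hw.le (by positivity), e]
    ring
  calc w ^ p / K * (n : ℝ) ^ (θ / 2)
      = (n : ℝ) ^ (p - 1) * (w ^ p * (m * n)) / (K * (m * (n : ℝ) ^ (p - θ / 2))) := by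
        have e : (n : ℝ) ^ (p - 1) * n = (n : ℝ) ^ (p - θ / 2) * (n : ℝ) ^ (θ / 2) := by
          rw [← Real.rpow_add_one hn0.ne', ← Real.rpow_add hn0]
          congr 1
          ring
        have hne : (n : ℝ) ^ (p - θ / 2) ≠ 0 := (Real.rpow_pos_of_pos hn0 _).ne'
        rw [div_mul_eq_mul_div, div_eq_div_iff (by positivity) (by positivity)]
        linear_combination (-(w ^ p * K * m)) * e
    _ ≤ _ := by
        have := mul_nonneg (Real.rpow_pos_of_pos hn0 (p - 1)).le (entrySum_nonneg p a x)
        rw [costRatio]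
        gcongr

/-- The mean cost for `p > 1` is at least of order `n ^ (θ / 2)` for some `θ > 1`. -/
theorem exists_le_lintegral_costRatio
    (hmean : ∫ t, t ∂ν = 0) (hvar : MemLp (fun t : ℝ => t) 2 ν) (hpos : 0 < ∫ t, t ^ 2 ∂ν)
    {p : ℝ} (hp : 1 < p) (hνp : MemLp (fun t : ℝ => t) (ENNReal.ofReal p) ν) :
    ∃ θ : ℝ, 1 < θ ∧ (p = 2 → θ = 2) ∧ ∃ c : ℝ, 0 < c ∧ ∃ N : ℕ, ∀ m n : ℕ, N ≤ m → 0 < n →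
      ENNReal.ofReal (c * (n : ℝ) ^ (θ / 2)) ≤
        ∫⁻ z, ENNReal.ofReal (costRatio p z.2 z.1) ∂(instanceLaw ν m n) := by
  obtain ⟨η, hη, C, hC, hsmall⟩ := exists_instanceLaw_smallImage_le hmean hvar hpos
  obtain ⟨θ, hθ, hθ2, D, hD, himage⟩ := exists_lintegral_imageSum_le hmean hvar hp hνp
  refine ⟨θ, hθ, hθ2, ?_⟩
  set s := ∫ t, t ^ 2 ∂ν with hs
  have hμ1 : 0 < ∫ t, |t| ∂ν := integral_abs_pos hvar hpos
  set μ := (∫ t, |t| ∂ν) ^ 2 with hμ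
  have hμ0 : 0 < μ := by positivity
  set q := μ ^ 2 / (2 * s ^ 2) with hq
  have hq0 : 0 < q := by positivity
  set K := 4 * D / q with hK
  have hK0 : 0 < K := by positivity
  set c := (μ / 4) ^ p / K with hc
  have hc0 : 0 < c := by positivity
  -- Here `q` is the Paley–Zygmund lower bound for the probability that `W_1 ≥ μ m n / 4`. The
  -- factor `4` in `K` and the choice of `N` let a large `V_p` and a small image each use up at most
  -- `q / 4`, so `q / 2` is left.
  refine ⟨q / 2 * c, by positivity, ⌈4 * C / q⌉₊ + 1, fun m n hm hn => ?_⟩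
  have hmq : 4 * C / q ≤ m := (Nat.le_ceil _).trans (by exact_mod_cast (by omega))
  have hm' : 0 < m := by omega
  have hm0 : (0 : ℝ) < m := by exact_mod_cast hm'
  have hn0 : (0 : ℝ) < n := by exact_mod_cast hn
  set T := (n : ℝ) ^ (θ / 2) with hT
  have hT0 : 0 < T := Real.rpow_pos_of_pos hn0 _
  set V₀ := K * (m * (n : ℝ) ^ (p - θ / 2)) with hV₀
  have hV₀0 : 0 < V₀ := by positivity
  -- A pointwise form of Paley–Zygmund: below the threshold the first term suffices; above it the
  -- last bracket is at least `1` and `W_1` is bounded by AM–GM. Integrating this bounds `E R_p`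
  -- directly, without handling an intersection of events.
  have hpt : ∀ z : (Fin n → ℝ) × (Fin m → Fin n → ℝ),
      ENNReal.ofReal (entrySum 1 z.2 z.1) ≤ ENNReal.ofReal (μ / 4 * (m * n)) +
        ENNReal.ofReal (μ / s ^ 2 / 2 / (m * n)) * ENNReal.ofReal (entrySum 1 z.2 z.1 ^ 2) +
        ENNReal.ofReal (s ^ 2 / (2 * μ) * (m * n)) *
          (ENNReal.ofReal (1 / (c * T)) * ENNReal.ofReal (costRatio p z.2 z.1) +
            ENNReal.ofReal (1 / V₀) * ENNReal.ofReal (imageSum p z.2 z.1) +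
            (smallImage m n η).indicator (fun _ => 1) z) := by
    rintro ⟨x, a⟩
    simp only
    have hW := entrySum_nonneg 1 a x
    by_cases hw : entrySum 1 a x < μ / 4 * (m * n)
    · refine le_add_right (le_add_right (ENNReal.ofReal_le_ofReal hw.le))
    push Not at hw
    have hind : (1 : ℝ≥0∞) ≤
        ENNReal.ofReal (1 / (c * T)) * ENNReal.ofReal (costRatio p a x) +
            ENNReal.ofReal (1 / V₀) * ENNReal.ofReal (imageSum p a x) +
            (smallImage m n η).indicator (fun _ => 1) (x, a) := by
      -- Here the cost is `0` by convention and gives no lower bound; but then `a x = 0`, which lies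
      -- in the small-image set as `x ≠ 0`.
      by_cases hV : imageSum p a x = 0
      · refine le_add_left ?_
        rw [Set.indicator_of_mem]
        have hx : x ≠ 0 := by
          rintro rfl
          have : entrySum 1 a (0 : Fin n → ℝ) = 0 := by simp [entrySum]
          rw [this] at hw
          exact absurd hw (not_le.2 (by positivity))
        refine ⟨hx, ?_⟩
        have h0 : imageSum 1 a x = 0 := by
          by_contra hne
          exact (imageSum_pos_of_one (p := p)
            (lt_of_le_of_ne (imageSum_nonneg _ _ _) (Ne.symm hne))).ne' hV
        change imageSum 1 a x ≤ η * m * euclid x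
        rw [h0]
        have := euclid_nonneg x
        positivity
      have hV0 : 0 < imageSum p a x := lt_of_le_of_ne (imageSum_nonneg _ _ _) (Ne.symm hV)
      refine le_add_right ?_
      rw [← ENNReal.ofReal_one]
      rcases le_total (imageSum p a x) V₀ with h | h
      · refine le_add_right ?_
        rw [← ENNReal.ofReal_mul (by positivity)]
        refine ENNReal.ofReal_le_ofReal ?_
        rw [one_div_mul_eq_div, one_le_div (by positivity)]
        exact le_costRatio hm' hn hp.le (by positivity) hK0 hw hV0 h
      · refine le_add_left ?_
        rw [← ENNReal.ofReal_mul (by positivity)]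
        refine ENNReal.ofReal_le_ofReal ?_
        rwa [one_div_mul_eq_div, one_le_div hV₀0]
    rw [add_assoc]
    refine le_add_left ?_
    refine le_trans ?_ (add_le_add_right (le_mul_of_one_le_right zero_le hind) _)
    rw [← ENNReal.ofReal_mul (by positivity), ← ENNReal.ofReal_add (by positivity) (by positivity)]
    refine ENNReal.ofReal_le_ofReal ?_
    -- The quadratic coefficient is chosen so that the second moment term integrates to at most half
    -- of the mean `μ m n`; with the quarter lost to the threshold, `μ m n / 4` remains.
    have h : 0 ≤ μ / s ^ 2 / 2 / (m * n) * (entrySum 1 a x - s ^ 2 / μ * (m * n)) ^ 2 := by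
      positivity
    have e : μ / s ^ 2 / 2 / (m * n) * (entrySum 1 a x - s ^ 2 / μ * (m * n)) ^ 2 =
        μ / s ^ 2 / 2 / (m * n) * entrySum 1 a x ^ 2 + s ^ 2 / (2 * μ) * (m * n) -
          entrySum 1 a x := by
      field_simp
      ring
    linarith
  have hI := lintegral_mono (μ := instanceLaw ν m n) hpt
  rw [lintegral_entrySum_one hvar, lintegral_add_right _ (by
      fun_prop (disch := exact measurableSet_smallImage m n η)),
    lintegral_add_right _ (by fun_prop), lintegral_const, measure_univ, mul_one,
    lintegral_const_mul _ (by fun_prop), lintegral_const_mul _ (by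
      fun_prop (disch := exact measurableSet_smallImage m n η)),
    lintegral_add_left (by fun_prop), lintegral_add_left (by fun_prop),
    lintegral_indicator_const (measurableSet_smallImage m n η), one_mul,
    lintegral_const_mul _ (by fun_prop), lintegral_const_mul _ (by fun_prop)] at hI
  by_cases htop : ∫⁻ z, ENNReal.ofReal (costRatio p z.2 z.1) ∂(instanceLaw ν m n) = ∞
  · rw [htop]; exact le_top
  obtain ⟨I, hI0, hIeq⟩ : ∃ I : ℝ, 0 ≤ I ∧
      ∫⁻ z, ENNReal.ofReal (costRatio p z.2 z.1) ∂(instanceLaw ν m n) = ENNReal.ofReal I :=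
    ⟨_, ENNReal.toReal_nonneg, (ENNReal.ofReal_toReal htop).symm⟩
  rw [hIeq] at hI ⊢
  have hI2 := hI.trans (add_le_add (add_le_add le_rfl (mul_le_mul_right
    (lintegral_entrySum_one_sq_le hvar m n) _)) (mul_le_mul_right (add_le_add (add_le_add le_rfl
      (mul_le_mul_right (himage m n hn) _)) (hsmall m n hm')) _))
  rw [← ENNReal.ofReal_mul (by positivity), ← ENNReal.ofReal_mul (by positivity),
    ← ENNReal.ofReal_mul (by positivity), ← ENNReal.ofReal_add (by positivity) (by positivity),
    ← ENNReal.ofReal_add (by positivity) (by positivity),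
    ← ENNReal.ofReal_add (by positivity) (by positivity), ← ENNReal.ofReal_mul (by positivity),
    ← ENNReal.ofReal_add (by positivity) (by positivity),
    ENNReal.ofReal_le_ofReal_iff (by positivity)] at hI2
  refine ENNReal.ofReal_le_ofReal ?_
  have e1 : 1 / V₀ * (D * (m * (n : ℝ) ^ (p - θ / 2))) = q / 4 := by
    have hne : (n : ℝ) ^ (p - θ / 2) ≠ 0 := (Real.rpow_pos_of_pos hn0 _).ne'
    rw [hV₀, hK]
    field_simp
  have e2 : C / m ≤ q / 4 := by
    rw [div_le_iff₀ hq0] at hmq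
    rw [div_le_div_iff₀ hm0 (by norm_num)]
    linarith
  have e3 : μ / s ^ 2 / 2 / (m * n) * ((m * n) ^ 2 * s ^ 2) = μ / 2 * (m * n) := by
    field_simp
  rw [e1, e3] at hI2
  have e4 : (m : ℝ) * n * (μ / 4) ≤
      (m * n) * (s ^ 2 / (2 * μ) * (1 / (c * T) * I + q / 4 + q / 4)) := by
    have : s ^ 2 / (2 * μ) * (m * n) * (1 / (c * T) * I + q / 4 + C / m) ≤
        s ^ 2 / (2 * μ) * (m * n) * (1 / (c * T) * I + q / 4 + q / 4) := by gcongr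
    linarith
  have e5 := le_of_mul_le_mul_left e4 (by positivity)
  have e6 : s ^ 2 / (2 * μ) * q = μ / 4 := by
    rw [hq]; field_simp; norm_num
  have e7 : s ^ 2 / (2 * μ) * q ≤ s ^ 2 / (2 * μ) * (1 / (c * T) * I + q / 4 + q / 4) := by
    rw [e6]; exact e5
  have e8 := le_of_mul_le_mul_left e7 (by positivity)
  have e9 : q / 2 ≤ I / (c * T) := by
    have : 1 / (c * T) * I = I / (c * T) := one_div_mul_eq_div _ _
    linarith
  rw [le_div_iff₀ (by positivity)] at e9
  linarith

end

/-! ### From instance averages to integrals of the cost ratio -/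

section

variable {Ω : Type*} [MeasurableSpace Ω] {P : Measure Ω} [IsProbabilityMeasure P]
  {ν : Measure ℝ} [IsProbabilityMeasure ν] {m n : ℕ}
  {A : Ω → Matrix (Fin m) (Fin n) ℝ} {x : Ω → Fin n → ℝ}

theorem measurePreserving_curry_pi (ν : Measure ℝ) [IsProbabilityMeasure ν] (m n : ℕ) :
    MeasurePreserving (fun (y : Fin m × Fin n → ℝ) i j => y (i, j)) (Measure.pi fun _ => ν)
      (Measure.pi fun _ => vecLaw ν n) := by
  refine ⟨by fun_prop, ?_⟩
  have h := Measure.infinitePi_map_curry (ι := Fin m) (κ := Fin n) (fun _ _ => ν)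
  simp_rw [Measure.infinitePi_eq_pi] at h
  exact h

theorem IIDEntries.hasLaw (h : IIDEntries P ν A x) :
    HasLaw (fun ω => (x ω, fun i j => A ω i j)) (instanceLaw ν m n) P := by
  have haem : ∀ e : (Fin m × Fin n) ⊕ Fin n, AEMeasurable (fun ω =>
      Sum.elim (fun ij : Fin m × Fin n => A ω ij.1 ij.2) (fun j => x ω j) e) P := by
    rintro (⟨i, j⟩ | j)
    · exact (h.law_matrix i j).aemeasurable
    · exact (h.law_vector j).aemeasurable
  have hlaw : HasLaw (fun ω e =>
      Sum.elim (fun ij : Fin m × Fin n => A ω ij.1 ij.2) (fun j => x ω j) e)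
      (Measure.pi fun _ => ν) P := by
    refine ⟨aemeasurable_pi_lambda _ haem, ?_⟩
    rw [(iIndepFun_iff_map_fun_eq_pi_map haem).1 h.indep]
    congr 1
    funext e
    rcases e with ⟨i, j⟩ | j
    · exact (h.law_matrix i j).map_eq
    · exact (h.law_vector j).map_eq
  have h1 := measurePreserving_sumPiEquivProdPi (X := fun _ : (Fin m × Fin n) ⊕ Fin n => ℝ)
    (fun _ => ν)
  have h2 := Measure.measurePreserving_swap.comp
    (((measurePreserving_curry_pi ν m n).prod (MeasurePreserving.id (vecLaw ν n))).comp h1)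
  exact h2.fun_comp_hasLaw hlaw

theorem measurableSet_mulVec_ne_zero (m n : ℕ) :
    MeasurableSet {z : (Fin n → ℝ) × (Fin m → Fin n → ℝ) |
      (z.2 : Matrix (Fin m) (Fin n) ℝ) *ᵥ z.1 ≠ 0} := by
  have h : Measurable fun z : (Fin n → ℝ) × (Fin m → Fin n → ℝ) =>
      fun i => ∑ j, z.2 i j * z.1 j := by fun_prop
  exact (h (measurableSet_singleton 0)).compl

/-- The cost ratio vanishes where `Ax = 0`, so its integral over everything equals that over the
conditioning event. The prefactor does not depend on `p` and is common to both sides of each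
comparison; if it is `∞`, the integral is `0`. -/
theorem IIDEntries.instanceAverage_expectedIterations (h : IIDEntries P ν A x) {p : ℝ}
    (hp : 1 ≤ p) :
    instanceAverage P A x (expectedIterations p) = (P {ω | A ω *ᵥ x ω ≠ 0})⁻¹ *
      ∫⁻ z, ENNReal.ofReal (costRatio p z.2 z.1) ∂(instanceLaw ν m n) := by
  have hnull : NullMeasurableSet {ω | A ω *ᵥ x ω ≠ 0} P :=
    h.hasLaw.aemeasurable.nullMeasurable (measurableSet_mulVec_ne_zero m n)
  rw [instanceAverage, ProbabilityTheory.cond, lintegral_smul_measure, smul_eq_mul]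
  congr 1
  rw [← h.hasLaw.map_eq, lintegral_map' (Measurable.aemeasurable (by fun_prop))
    h.hasLaw.aemeasurable, ← lintegral_indicator₀ hnull]
  refine lintegral_congr fun ω => ?_
  by_cases hω : A ω *ᵥ x ω = 0
  · rw [Set.indicator_of_notMem (by simpa using hω)]
    exact (ENNReal.ofReal_eq_zero.2 (costRatio_eq_zero hp (A ω) (x ω) hω).le).symm
  · rw [Set.indicator_of_mem (by simpa using hω)]
    exact expectedIterations_eq_costRatio hp _ _ hω

theorem instanceAverage_expectedQueries (P : Measure Ω) (A : Ω → Matrix (Fin m) (Fin n) ℝ)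
    (x : Ω → Fin n → ℝ) (p : ℝ) :
    instanceAverage P A x (expectedQueries p) =
      (queriesPerIteration n : ℝ≥0∞) * instanceAverage P A x (expectedIterations p) := by
  simp_rw [instanceAverage, expectedQueries_eq]
  exact lintegral_const_mul' _ _ (ENNReal.natCast_ne_top _)

/-- If the entries vanish almost surely, so does the mean cost. -/
theorem lintegral_costRatio_eq_zero (hvar : MemLp (fun t : ℝ => t) 2 ν)
    (h0 : ∫ t, t ^ 2 ∂ν = 0) (p : ℝ) (hp : 1 ≤ p) (m n : ℕ) :
    ∫⁻ z, ENNReal.ofReal (costRatio p z.2 z.1) ∂(instanceLaw ν m n) = 0 := by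
  have h1 : ∀ᵐ t ∂ν, t = 0 := by
    refine ((integral_eq_zero_iff_of_nonneg (fun t => sq_nonneg t) hvar.integrable_sq).1 h0).mono
      fun t ht => ?_
    simpa using ht
  have h2 : ∀ᵐ z ∂(instanceLaw ν m n), ∀ j, z.1 j = 0 :=
    ae_all_iff.2 fun j => ((measurePreserving_eval (fun _ : Fin n => ν) j).comp
      measurePreserving_fst).quasiMeasurePreserving.ae h1
  rw [lintegral_eq_zero_iff (by fun_prop)]
  filter_upwards [h2] with z hz
  have hz0 : z.1 = 0 := funext hz
  simp [costRatio, entrySum, imageSum, hz0, Real.zero_rpow (show p ≠ 0 by linarith)]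

end

/-! ### Comparison of the mean costs -/

/-- For `p > 1` the mean cost for `p = 1` is eventually at most the mean cost for `p`. -/
theorem exists_lintegral_costRatio_one_le_lintegral_costRatio {ν : Measure ℝ}
    [IsProbabilityMeasure ν] (hmean : ∫ t, t ∂ν = 0) (hvar : MemLp (fun t : ℝ => t) 2 ν)
    (hpos : 0 < ∫ t, t ^ 2 ∂ν) {p : ℝ} (hp : 1 < p)
    (hνp : MemLp (fun t : ℝ => t) (ENNReal.ofReal p) ν) :
    ∃ N : ℕ, ∀ m n : ℕ, N ≤ m → N ≤ n →
      ∫⁻ z, ENNReal.ofReal (costRatio 1 z.2 z.1) ∂(instanceLaw ν m n) ≤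
        ∫⁻ z, ENNReal.ofReal (costRatio p z.2 z.1) ∂(instanceLaw ν m n) := by
  obtain ⟨C, hC, hU⟩ := exists_lintegral_costRatio_one_le hmean hvar hpos
  obtain ⟨θ, hθ, -, c, hc, N, hL⟩ := exists_le_lintegral_costRatio hmean hvar hpos hp hνp
  have hlim1 : Tendsto (fun n : ℕ => (n : ℝ) ^ ((θ - 1) / 2)) atTop atTop :=
    (tendsto_rpow_atTop (by linarith)).comp tendsto_natCast_atTop_atTop
  have hlim2 : Tendsto (fun n : ℕ => (n : ℝ) ^ ((p - 1) / 2)) atTop atTop :=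
    (tendsto_rpow_atTop (by linarith)).comp tendsto_natCast_atTop_atTop
  -- The two thresholds make each term of the upper bound at most half of the mean cost for `p`.
  obtain ⟨N', hN'⟩ := eventually_atTop.1
    ((hlim1.eventually_ge_atTop (2 * C / c)).and (hlim2.eventually_ge_atTop 2))
  refine ⟨max (max N N') 1, fun m n hm hn => ?_⟩
  simp only [max_le_iff] at hm hn
  obtain ⟨h1, h2⟩ := hN' n hn.1.2
  have hn0 : (0 : ℝ) < n := by exact_mod_cast hn.2
  set I := ∫⁻ z, ENNReal.ofReal (costRatio p z.2 z.1) ∂(instanceLaw ν m n)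
  have e1 : C * √n ≤ 1 / 2 * (c * (n : ℝ) ^ (θ / 2)) := by
    have : (n : ℝ) ^ (θ / 2) = (n : ℝ) ^ ((θ - 1) / 2) * √n := by
      rw [Real.sqrt_eq_rpow, ← Real.rpow_add hn0]; congr 1; ring
    rw [this]
    rw [div_le_iff₀ hc] at h1
    nlinarith [Real.sqrt_nonneg (n : ℝ)]
  have e2 : √n ^ (1 - p) ≤ 1 / 2 := by
    have : √n ^ (1 - p) = ((n : ℝ) ^ ((p - 1) / 2))⁻¹ := by
      rw [Real.sqrt_eq_rpow, ← Real.rpow_mul hn0.le, ← Real.rpow_neg hn0.le]; congr 1; ring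
    rw [this, one_div]
    exact inv_anti₀ two_pos h2
  calc _ ≤ ENNReal.ofReal (C * √n) + ENNReal.ofReal (√n ^ (1 - p)) * I :=
        hU m n hm.2 hn.2 p hp.le
    _ ≤ ENNReal.ofReal (1 / 2) * I + ENNReal.ofReal (1 / 2) * I := by
        gcongr
        refine (ENNReal.ofReal_le_ofReal e1).trans ?_
        rw [ENNReal.ofReal_mul (by norm_num)]
        gcongr
        exact hL m n hm.1.1 hn.2
    _ = I := by
        rw [← add_mul, ← ENNReal.ofReal_add (by norm_num) (by norm_num)]
        norm_num

/-- The mean cost for `p = 1` is `O(1 / √n)` times the mean cost for `p = 2`. -/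
theorem exists_lintegral_costRatio_one_le_div_sqrt {ν : Measure ℝ}
    [IsProbabilityMeasure ν] (hmean : ∫ t, t ∂ν = 0) (hvar : MemLp (fun t : ℝ => t) 2 ν)
    (hpos : 0 < ∫ t, t ^ 2 ∂ν) :
    ∃ C : ℝ, ∃ N : ℕ, ∀ m n : ℕ, N ≤ m → N ≤ n →
      ∫⁻ z, ENNReal.ofReal (costRatio 1 z.2 z.1) ∂(instanceLaw ν m n) ≤
        ENNReal.ofReal (C / √n) *
          ∫⁻ z, ENNReal.ofReal (costRatio 2 z.2 z.1) ∂(instanceLaw ν m n) := by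
  obtain ⟨C, hC, hU⟩ := exists_lintegral_costRatio_one_le hmean hvar hpos
  obtain ⟨θ, -, hθ, c, hc, N, hL⟩ := exists_le_lintegral_costRatio hmean hvar hpos
    (p := 2) (by norm_num) (by simpa using hvar)
  -- `C / c` comes from `C √n` against the lower bound `c n`, and `1` from the factor `√n^(1-2) = 1
  -- / √n`.
  refine ⟨C / c + 1, max N 1, fun m n hm hn => ?_⟩
  simp only [max_le_iff] at hm hn
  have hn0 : (0 : ℝ) < n := by exact_mod_cast hn.2
  have hs : 0 < √(n : ℝ) := Real.sqrt_pos.2 hn0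
  set I := ∫⁻ z, ENNReal.ofReal (costRatio 2 z.2 z.1) ∂(instanceLaw ν m n)
  have hI := hL m n hm.1 hn.2
  rw [hθ rfl, div_self two_ne_zero, Real.rpow_one] at hI
  have e1 : C * √n = C / c / √n * (c * n) := by
    field_simp
    rw [Real.sq_sqrt hn0.le]
  have e2 : √n ^ (1 - 2 : ℝ) = 1 / √n := by
    rw [show (1 - 2 : ℝ) = -1 by norm_num, Real.rpow_neg_one, one_div]
  calc _ ≤ ENNReal.ofReal (C * √n) + ENNReal.ofReal (√n ^ (1 - 2 : ℝ)) * I :=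
        hU m n hm.2 hn.2 2 (by norm_num)
    _ ≤ ENNReal.ofReal (C / c / √n) * I + ENNReal.ofReal (1 / √n) * I := by
        rw [e1, e2, ENNReal.ofReal_mul (by positivity)]
        gcongr
    _ = _ := by
        rw [← add_mul, ← ENNReal.ofReal_add (by positivity) (by positivity), ← add_div]

end LpSampling

theorem mainTheorem3 (ν : Measure ℝ) [IsProbabilityMeasure ν]
    (hmean : ∫ t, t ∂ν = 0) (hvar : MemLp (fun t : ℝ => t) 2 ν) :
    (∀ p : ℝ, 1 ≤ p → MemLp (fun t : ℝ => t) (ENNReal.ofReal p) ν →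
      ∃ N : ℕ, ∀ m n : ℕ, N ≤ m → N ≤ n →
        ∀ (Ω : Type*) [MeasurableSpace Ω] (P : Measure Ω) [IsProbabilityMeasure P]
          (A : Ω → Matrix (Fin m) (Fin n) ℝ) (x : Ω → Fin n → ℝ),
          LpSampling.IIDEntries P ν A x →
            LpSampling.instanceAverage P A x (LpSampling.expectedQueries 1) ≤
              LpSampling.instanceAverage P A x (LpSampling.expectedQueries p)) ∧
    (∃ C : ℝ, ∃ N : ℕ, ∀ m n : ℕ, N ≤ m → N ≤ n →
      ∀ (Ω : Type*) [MeasurableSpace Ω] (P : Measure Ω) [IsProbabilityMeasure P]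
        (A : Ω → Matrix (Fin m) (Fin n) ℝ) (x : Ω → Fin n → ℝ),
        LpSampling.IIDEntries P ν A x →
          LpSampling.instanceAverage P A x (LpSampling.expectedIterations 1) ≤
            ENNReal.ofReal (C / Real.sqrt n) *
              LpSampling.instanceAverage P A x (LpSampling.expectedIterations 2)) := by
  have hs : 0 ≤ ∫ t, t ^ 2 ∂ν := integral_nonneg fun t => sq_nonneg t
  refine ⟨fun p hp hνp => ?_, ?_⟩
  · obtain ⟨N, hN⟩ : ∃ N : ℕ, ∀ m n : ℕ, N ≤ m → N ≤ n →
        ∫⁻ z, ENNReal.ofReal (LpSampling.costRatio 1 z.2 z.1) ∂(LpSampling.instanceLaw ν m n) ≤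
          ∫⁻ z, ENNReal.ofReal (LpSampling.costRatio p z.2 z.1)
            ∂(LpSampling.instanceLaw ν m n) := by
      -- With zero variance all entries vanish almost surely and the left side is `0`.
      rcases hs.eq_or_lt with h0 | hpos
      · refine ⟨0, fun m n _ _ => ?_⟩
        rw [LpSampling.lintegral_costRatio_eq_zero hvar h0.symm 1 le_rfl]
        exact zero_le
      rcases hp.eq_or_lt with rfl | hp1
      · exact ⟨0, fun _ _ _ _ => le_rfl⟩
      · exact LpSampling.exists_lintegral_costRatio_one_le_lintegral_costRatio hmean hvar hpos
          hp1 hνp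
    refine ⟨N, fun m n hm hn Ω _ P _ A x h => ?_⟩
    rw [LpSampling.instanceAverage_expectedQueries, LpSampling.instanceAverage_expectedQueries,
      h.instanceAverage_expectedIterations le_rfl, h.instanceAverage_expectedIterations hp]
    gcongr _ * (_ * ?_)
    exact hN m n hm hn
  · obtain ⟨C, N, hN⟩ : ∃ C : ℝ, ∃ N : ℕ, ∀ m n : ℕ, N ≤ m → N ≤ n →
        ∫⁻ z, ENNReal.ofReal (LpSampling.costRatio 1 z.2 z.1) ∂(LpSampling.instanceLaw ν m n) ≤
          ENNReal.ofReal (C / Real.sqrt n) *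
            ∫⁻ z, ENNReal.ofReal (LpSampling.costRatio 2 z.2 z.1)
              ∂(LpSampling.instanceLaw ν m n) := by
      rcases hs.eq_or_lt with h0 | hpos
      · refine ⟨0, 0, fun m n _ _ => ?_⟩
        rw [LpSampling.lintegral_costRatio_eq_zero hvar h0.symm 1 le_rfl]
        exact zero_le
      · exact LpSampling.exists_lintegral_costRatio_one_le_div_sqrt hmean hvar hpos
    refine ⟨C, N, fun m n hm hn Ω _ P _ A x h => ?_⟩
    rw [h.instanceAverage_expectedIterations le_rfl,
      h.instanceAverage_expectedIterations one_le_two, mul_left_comm]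
    gcongr
    exact hN m n hm hn
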